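/- **Setting.** Let $Y$ be a real or complex Banach space and $\mathbf A=(A_n)_{n\in\mathbb Z}$ a sequence in $\mathcal L(Y)$, not assumed uniformly bounded. For $n\ge m$ put $U_{\mathbf A}(n,m)=A_{n-1}\cdots A_m$ if $n>m$ and $U_{\mathbf A}(n,n)=I_Y$. **Definition.** $U_{\mathbf A}$ has an exponential trichotomy on $\mathbb Z$ with constant $\kappa$ and exponents $0<\rho_0<\rho$, associated to the families of bounded projectors $\Pi^\alpha=(\Pi^\alpha_n)_{n\in\mathbb Z}\subset\mathcal L(Y)$, $\alpha\in\{s,c,u\}$, if: (i) for all $n$, $\Pi^\alpha_n\Pi^\beta_n=0$ for $\alpha\ne\beta$, and $\Pi^s_n+\Pi^u_n+\Pi^c_n=I_Y$; (ii) $U^\alpha_{\mathbf A}(n,m):=\Pi^\alpha_nU_{\mathbf A}(n,m)=U_{\mathbf A}(n,m)\Pi^\alpha_m$ for all $n\ge m$ and $\alpha=s,c,u$; (iii) for $\alpha=u,c$ and $n\ge m$, $U^\alpha_{\mathbf A}(n,m)$ is invertible from $\mathcal R(\Pi^\alpha_m)$ onto $\mathcal R(\Pi^\alpha_n)$. For $n>m$,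 write $U^\alpha_{\mathbf A}(m,n)\in\mathcal L(Y)$ for the inverse composed with $\Pi^\alpha_n$, that is, $U^\alpha_{\mathbf A}(m,n)y=\big(U_{\mathbf A}(n,m)|_{\mathcal R(\Pi^\alpha_m)\to\mathcal R(\Pi^\alpha_n)}\big)^{-1}\Pi^\alpha_ny$; (iv) for all $y\in Y$: $\|U^c_{\mathbf A}(n,m)\Pi^c_my\|\le\kappa e^{\rho_0|n-m|}\|y\|$ for all $n,m\in\mathbb Z$, and, for $n\ge m$, $\|U^s_{\mathbf A}(n,m)\Pi^s_my\|\le\kappa e^{-\rho(n-m)}\|y\|$ and $\|U^u_{\mathbf A}(m,n)\Pi^u_ny\|\le\kappa e^{-\rho(n-m)}\|y\|$. **Theorem (Perturbation).** Let $0<\rho_0<\widehat\rho_0<\widehat\rho<\rho$ and $1\le\kappa<\widehat\kappa$. There is $\delta_0\in(0,\sqrt2-1)$, depending only on $\rho_0,\widehat\rho_0,\widehat\rho,\rho,\kappa,\widehat\kappa$, such that the following holds. Let $Y$ be a Banach space and $\mathbf A:\mathbb Z\to\mathcal L(Y)$ be such that $U_{\mathbf A}$ has an exponential trichotomy on $\mathbb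 Z$ with constant $\kappa$, exponents $\rho_0<\rho$ and projectors $\Pi^\alpha$, $\alpha=s,c,u$. Then for each $\delta\in\left(0,\frac{\delta_0^2}{\kappa+\delta_0}\right)$ and each $\mathbf B:\mathbb Z\to\mathcal L(Y)$ with $\sup_{n\in\mathbb Z}\|B_n\|\le\delta$, the family $U_{\mathbf A+\mathbf B}$ has an exponential trichotomy on $\mathbb Z$ with constant $\widehat\kappa$, exponents $\widehat\rho_0<\widehat\rho$ and some projectors $\widehat\Pi^\alpha$, $\alpha=s,c,u$, such that 1. for each $n\in\mathbb Z$ and $\alpha=s,c,u$, the spaces $\mathcal R(\Pi^\alpha_n)$ and $\mathcal R(\widehat\Pi^\alpha_n)$ are linearly homeomorphic; 2. if $U^\alpha_{\mathbf A+\mathbf B}$ is formed with the projectors $\widehat\Pi^\alpha$, then for all integers $n\ge p$, $$\|U^s_{\mathbf A+\mathbf B}(n,p)-U^s_{\mathbf A}(n,p)\|\le\frac{\kappa\delta}{\delta_0-\delta}e^{-\widehat\rho(n-p)},\qquad \|U^u_{\mathbf A+\mathbf B}(p,n)-U^u_{\mathbf A}(p,n)\|\le\frac{\kappa\delta}{\delta_0-\delta}e^{-\widehat\rho(n-p)},$$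 and for all $n,p\in\mathbb Z$, $$\|U^c_{\mathbf A+\mathbf B}(n,p)-U^c_{\mathbf A}(n,p)\|\le\frac{\kappa\delta}{\delta_0-\delta}e^{\widehat\rho_0|n-p|}.$$ -/

import Mathlib

/-- The three parts of a trichotomy. -/
inductive TrichotomyPart
  | stable
  | central
  | unstable

section Evolution

variable {𝕜 : Type*} [RCLike 𝕜] {Y : Type*} [NormedAddCommGroup Y] [NormedSpace 𝕜 Y]

/-- The product `A (m + k - 1) ∘ ⋯ ∘ A m` of `k` consecutive operators, starting at time `m`. -/
def evolutionSteps (A : ℤ → Y →L[𝕜] Y) (m : ℤ) : ℕ → Y →L[𝕜] Y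
  | 0 => ContinuousLinearMap.id 𝕜 Y
  | k + 1 => (A (m + k)).comp (evolutionSteps A m k)

/-- The evolution family `U_A(n, m) = A (n - 1) ∘ ⋯ ∘ A m` for `m ≤ n`, with `U_A(n, n) = id`.
It is only used for `m ≤ n`. -/
def evolution (A : ℤ → Y →L[𝕜] Y) (n m : ℤ) : Y →L[𝕜] Y :=
  evolutionSteps A m (n - m).toNat

/-- The operator `P n ∘ U_A(n, m)`, viewed as a bounded operator from the range of `P m`
into the range of `P n`. When `P n ∘ U_A(n, m) = U_A(n, m) ∘ P m` and `P m` is a projector,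
this is the restriction of `U_A(n, m)` to the range of `P m`. -/
def evolutionOnRange (A P : ℤ → Y →L[𝕜] Y) (n m : ℤ) :
    (P m).range →L[𝕜] (P n).range :=
  ((((P n).comp (evolution A n m)).comp (P m).range.subtypeL)).codRestrict (P n).range
    (fun y => ⟨evolution A n m y, rfl⟩)

/-- The evolution operators of `A` on the part given by the projectors `P`, as bounded operators
on the whole space. If `m ≤ n`, this is `P n ∘ U_A(n, m)`. If `n < m`, this is the inverse of
`U_A(m, n) : range (P n) → range (P m)` applied after the projector `P m`. -/
noncomputable def partEvolution (A P : ℤ → Y →L[𝕜] Y) (n m : ℤ) : Y →L[𝕜] Y :=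
  if m ≤ n then (P n).comp (evolution A n m)
  else (P n).range.subtypeL.comp
    ((evolutionOnRange A P m n).inverse.comp
      ((P m).codRestrict (P m).range (fun y => ⟨y, rfl⟩)))

/-- The evolution family of `A` has an exponential trichotomy on `ℤ` with constant `κ`,
exponents `0 < ρ₀ < ρ`, associated to the three families of projectors `P`. -/
structure HasExpTrichotomy (A : ℤ → Y →L[𝕜] Y) (κ ρ₀ ρ : ℝ)
    (P : TrichotomyPart → ℤ → Y →L[𝕜] Y) : Prop where
  exponent_pos : 0 < ρ₀
  exponent_lt : ρ₀ < ρ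
  projector : ∀ (a : TrichotomyPart) (n : ℤ), (P a n).comp (P a n) = P a n
  orthogonal : ∀ (n : ℤ) (a b : TrichotomyPart), a ≠ b → (P a n).comp (P b n) = 0
  sum_eq_id : ∀ n : ℤ,
    P .stable n + P .unstable n + P .central n = ContinuousLinearMap.id 𝕜 Y
  commute : ∀ (a : TrichotomyPart) (n m : ℤ), m ≤ n →
    (P a n).comp (evolution A n m) = (evolution A n m).comp (P a m)
  invertible_unstable : ∀ n m : ℤ, m ≤ n →
    (evolutionOnRange A (P .unstable) n m).IsInvertible
  invertible_central : ∀ n m : ℤ, m ≤ n →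
    (evolutionOnRange A (P .central) n m).IsInvertible
  central_bound : ∀ (y : Y) (n m : ℤ),
    ‖partEvolution A (P .central) n m (P .central m y)‖
      ≤ κ * Real.exp (ρ₀ * |(n : ℝ) - m|) * ‖y‖
  stable_bound : ∀ (y : Y) (n m : ℤ), m ≤ n →
    ‖partEvolution A (P .stable) n m (P .stable m y)‖
      ≤ κ * Real.exp (-ρ * ((n : ℝ) - m)) * ‖y‖
  unstable_bound : ∀ (y : Y) (n m : ℤ), m ≤ n →
    ‖partEvolution A (P .unstable) m n (P .unstable n y)‖
      ≤ κ * Real.exp (-ρ * ((n : ℝ) - m)) * ‖y‖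

end Evolution

/-! ### Linear fixed-point equations on weighted sequence spaces -/

section WeightedFixedPoint

variable {R : Type*} [NormedRing R]

/-! A trichotomy is two nested dichotomies, and each dichotomy is encoded by a Green kernel of the
difference equation. The kernel `G` separates stable from central and unstable: it is the stable
evolution forward in time and minus the central-unstable evolution backward, with rates `-ρ` and
`-ρ₀`. The kernel `H` separates stable and central from unstable, with rates `ρ₀` and `ρ`. The
projectors are `G n n`, `H n n - G n n` and `1 - H n n`.

Green kernels perturb well. The kernel of `A + B` should solve `G' n m = G n m + ∑ G n (k+1) * B k *
G' k m`. The bounds on `G` make this equation a contraction for small `B` in any exponential weight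
with rate strictly inside the gap, uniformly in `n` and `m` and with no uniform bound on `A`.
Existence gives the forward equation and the error bounds. The equation in the second variable
follows from uniqueness (`IsGreenKernel.exists_perturbation`).

It remains to read a trichotomy off the perturbed kernels. `G m m` fixes the initial value of a
forward solution growing slower than the backward rate, and kills the final value of a backward
solution decaying faster than the forward rate. Applied to the columns of kernels, this gives
idempotence and the nesting of the two dichotomies. The backward parts of the kernels supply the
inverses of the evolution on the central and unstable ranges (`hasExpTrichotomy_of_isGreenKernel`).
Ranges are homeomorphic because nearby projectors are conjugate. -/

/-- Terms of a Neumann series for the kernel `L`, starting from the sequence `g`. -/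
noncomputable def neumannTerm (L : ℤ → ℤ → R) (g : ℤ → R) : ℕ → ℤ → R
  | 0 => g
  | j + 1 => fun n => ∑' k, L n k * neumannTerm L g j k

theorem norm_mul_le_of_weighted {L : ℤ → ℤ → R} {w : ℤ → ℝ} {x : ℤ → R} {M : ℝ}
    (hx : ∀ n, ‖x n‖ ≤ M * w n) (n k : ℤ) :
    ‖L n k * x k‖ ≤ M * (‖L n k‖ * w k) :=
  calc ‖L n k * x k‖ ≤ ‖L n k‖ * ‖x k‖ := norm_mul_le _ _
    _ ≤ ‖L n k‖ * (M * w k) := by gcongr; exact hx k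
    _ = M * (‖L n k‖ * w k) := by ring

/-- Schur test: the hypothesis on `L` says that the associated operator has norm at most `θ` for the
norm `sup ‖x n‖ / w n`. -/
theorem norm_tsum_mul_le_of_weighted {L : ℤ → ℤ → R} {w : ℤ → ℝ} {θ : ℝ}
    (hs : ∀ n, Summable fun k => ‖L n k‖ * w k) (hθ : ∀ n, ∑' k, ‖L n k‖ * w k ≤ θ * w n)
    {x : ℤ → R} {M : ℝ} (hM : 0 ≤ M) (hx : ∀ n, ‖x n‖ ≤ M * w n) (n : ℤ) :
    ‖∑' k, L n k * x k‖ ≤ θ * M * w n :=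
  calc ‖∑' k, L n k * x k‖ ≤ ∑' k, M * (‖L n k‖ * w k) :=
        tsum_of_norm_bounded ((hs n).mul_left M).hasSum (norm_mul_le_of_weighted hx n)
    _ = M * ∑' k, ‖L n k‖ * w k := tsum_mul_left
    _ ≤ M * (θ * w n) := by gcongr; exact hθ n
    _ = θ * M * w n := by ring

theorem norm_neumannTerm_le {L : ℤ → ℤ → R} {w : ℤ → ℝ} {θ : ℝ} (hθ0 : 0 ≤ θ)
    (hs : ∀ n, Summable fun k => ‖L n k‖ * w k) (hθ : ∀ n, ∑' k, ‖L n k‖ * w k ≤ θ * w n)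
    {g : ℤ → R} {M : ℝ} (hM : 0 ≤ M) (hg : ∀ n, ‖g n‖ ≤ M * w n) (j : ℕ) (n : ℤ) :
    ‖neumannTerm L g j n‖ ≤ θ ^ j * M * w n := by
  induction j generalizing n with
  | zero => simpa [neumannTerm] using hg n
  | succ j ih =>
    refine (norm_tsum_mul_le_of_weighted hs hθ (by positivity) ih n).trans_eq ?_
    ring

theorem summable_mul_of_weighted [CompleteSpace R] {L : ℤ → ℤ → R} {w : ℤ → ℝ}
    (hs : ∀ n, Summable fun k => ‖L n k‖ * w k)
    {x : ℤ → R} {M : ℝ} (hx : ∀ n, ‖x n‖ ≤ M * w n) (n : ℤ) :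
    Summable fun k => L n k * x k :=
  Summable.of_norm_bounded ((hs n).mul_left M) (norm_mul_le_of_weighted hx n)

/-- A kernel which is contracting for the weight `w` has a fixed point with inhomogeneity `g`. -/
theorem exists_weighted_fixedPoint [CompleteSpace R] {L : ℤ → ℤ → R} {w : ℤ → ℝ} {θ : ℝ}
    (hw : ∀ n, 0 ≤ w n) (hθ0 : 0 ≤ θ) (hθ1 : θ < 1)
    (hs : ∀ n, Summable fun k => ‖L n k‖ * w k) (hθ : ∀ n, ∑' k, ‖L n k‖ * w k ≤ θ * w n)
    {g : ℤ → R} {M : ℝ} (hM : 0 ≤ M) (hg : ∀ n, ‖g n‖ ≤ M * w n) :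
    ∃ x : ℤ → R, (∀ n, x n = g n + ∑' k, L n k * x k) ∧ ∀ n, ‖x n‖ ≤ (1 - θ)⁻¹ * M * w n := by
  have hb := norm_neumannTerm_le hθ0 hs hθ hM hg
  have hgeo := hasSum_geometric_of_lt_one hθ0 hθ1
  have hgeo' : ∀ n, HasSum (fun j => θ ^ j * M * w n) ((1 - θ)⁻¹ * M * w n) := fun n =>
    (hgeo.mul_right M).mul_right (w n)
  have hsum : ∀ n, Summable fun j => neumannTerm L g j n := fun n =>
    Summable.of_norm_bounded (hgeo' n).summable fun j => hb j n
  refine ⟨fun n => ∑' j, neumannTerm L g j n, fun n => ?_, fun n =>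
    tsum_of_norm_bounded (hgeo' n) fun j => hb j n⟩
  -- The double series is dominated by the product of a geometric series in `j` and the weighted row
  -- sum in `k`, so the two sums may be exchanged.
  have hprod : Summable (Function.uncurry fun (j : ℕ) (k : ℤ) => L n k * neumannTerm L g j k) := by
    refine Summable.of_norm_bounded
      ((hgeo.summable.mul_right M).mul_of_nonneg (hs n) (fun j => by positivity)
        fun k => mul_nonneg (norm_nonneg _) (hw k)) fun p => ?_
    exact norm_mul_le_of_weighted (hb p.1) n p.2
  beta_reduce
  rw [(hsum n).tsum_eq_zero_add]
  congr 1
  calc ∑' j, neumannTerm L g (j + 1) n = ∑' (j : ℕ) (k : ℤ), L n k * neumannTerm L g j k := rfl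
    _ = ∑' (k : ℤ) (j : ℕ), L n k * neumannTerm L g j k := hprod.tsum_comm.symm
    _ = ∑' k, L n k * ∑' j, neumannTerm L g j k := by
      congr 1; ext k; exact (hsum k).tsum_mul_left _

/-- Feeding the bound on `x` back into the equation gains a factor `θ` each time. This uniqueness is
what later yields the equation in the second variable of the perturbed kernel. -/
theorem eq_zero_of_weighted_fixedPoint {L : ℤ → ℤ → R} {w : ℤ → ℝ} {θ : ℝ}
    (hθ0 : 0 ≤ θ) (hθ1 : θ < 1)
    (hs : ∀ n, Summable fun k => ‖L n k‖ * w k) (hθ : ∀ n, ∑' k, ‖L n k‖ * w k ≤ θ * w n)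
    {x : ℤ → R} {M : ℝ} (hM : 0 ≤ M) (hx : ∀ n, ‖x n‖ ≤ M * w n)
    (hfix : ∀ n, x n = ∑' k, L n k * x k) (n : ℤ) : x n = 0 := by
  have hb : ∀ (j : ℕ) (n : ℤ), ‖x n‖ ≤ θ ^ j * M * w n := by
    intro j
    induction j with
    | zero => simpa using hx
    | succ j ih =>
      intro n
      rw [hfix n]
      refine (norm_tsum_mul_le_of_weighted hs hθ (by positivity) ih n).trans_eq ?_
      ring
  have hlim : Filter.Tendsto (fun j : ℕ => θ ^ j * M * w n) Filter.atTop (nhds (0 * M * w n)) :=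
    ((tendsto_pow_atTop_nhds_zero_of_lt_one hθ0 hθ1).mul_const M).mul_const (w n)
  rw [zero_mul, zero_mul] at hlim
  exact norm_le_zero_iff.1 (ge_of_tendsto' hlim fun j => hb j n)

end WeightedFixedPoint

/-! ### Convolution kernels for exponential weights -/

section ExponentialWeights

/-- The weight `min (exp (a j)) (exp (b j))` conjugated by `exp (c j)`, shifted by one step. -/
noncomputable def expKernel (a b c : ℝ) (j : ℤ) : ℝ :=
  min (Real.exp (a * j)) (Real.exp (b * j)) * Real.exp (-c * (j + 1))

theorem expKernel_nonneg (a b c : ℝ) (j : ℤ) : 0 ≤ expKernel a b c j := by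
  unfold expKernel; positivity

/-- The first branch of the minimum gives geometric decay at rate `a - c` as `j → ∞`, the second at
rate `b - c` as `j → -∞`. -/
theorem summable_expKernel {a b c : ℝ} (hac : a < c) (hcb : c < b) :
    Summable (expKernel a b c) := by
  have hgeom : ∀ {r : ℝ}, r < 0 → Summable fun j : ℕ => Real.exp (-c) * Real.exp (r * j) := by
    intro r hr
    refine Summable.mul_left _ ?_
    have := summable_geometric_of_lt_one (Real.exp_nonneg r) (by simpa using hr)
    refine this.congr fun j => ?_
    rw [← Real.exp_nat_mul, mul_comm]
  refine Summable.of_nat_of_neg ?_ ?_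
  · refine (hgeom (sub_neg.2 hac)).of_nonneg_of_le (fun j => expKernel_nonneg _ _ _ _) fun j => ?_
    calc expKernel a b c j ≤ Real.exp (a * j) * Real.exp (-c * (j + 1)) := by
          unfold expKernel; push_cast; gcongr; exact min_le_left _ _
      _ = Real.exp (-c) * Real.exp ((a - c) * j) := by
          rw [← Real.exp_add, ← Real.exp_add]; ring_nf
  · refine (hgeom (sub_neg.2 hcb)).of_nonneg_of_le (fun j => expKernel_nonneg _ _ _ _) fun j => ?_
    calc expKernel a b c (-j) ≤ Real.exp (b * (-j)) * Real.exp (-c * (-j + 1)) := by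
          unfold expKernel; push_cast; gcongr; exact min_le_right _ _
      _ = Real.exp (-c) * Real.exp ((c - b) * j) := by
          rw [← Real.exp_add, ← Real.exp_add]; ring_nf

end ExponentialWeights

/-! ### Green kernels as weighted operators -/

section GreenKernel

variable {R : Type*} [NormedRing R]

/-- `G` is a Green kernel of the difference equation `x (n + 1) = A n * x n`, decaying at rate
`a` forward and at rate `b` backward in time. -/
structure IsGreenKernel (A : ℤ → R) (G : ℤ → ℤ → R) (a b K : ℝ) : Prop where
  succ_left : ∀ n m, G (n + 1) m = A n * G n m + if n + 1 = m then 1 else 0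
  succ_right : ∀ n m, G n m = G n (m + 1) * A m + if n = m then 1 else 0
  bound_left : ∀ n m : ℤ, ‖G n m‖ ≤ K * Real.exp (a * ((n : ℝ) - m))
  bound_right : ∀ n m : ℤ, ‖G n m‖ ≤ K * Real.exp (b * ((n : ℝ) - m))

variable {A : ℤ → R} {G : ℤ → ℤ → R} {a b K : ℝ}

theorem IsGreenKernel.const_nonneg (hG : IsGreenKernel A G a b K) : 0 ≤ K := by
  simpa using (norm_nonneg _).trans (hG.bound_left 0 0)

/-- After factoring out the weight at `n`, what remains depends only on `n - 1 - k`. Row sums are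
therefore controlled by one constant, the same for all `n` and `m`. -/
theorem IsGreenKernel.weighted_le (hG : IsGreenKernel A G a b K) {B : ℤ → R} {δ : ℝ}
    (hB : ∀ n, ‖B n‖ ≤ δ) (c : ℝ) (n m k : ℤ) :
    ‖G n (k + 1) * B k‖ * Real.exp (c * ((k : ℝ) - m))
      ≤ K * δ * Real.exp (c * ((n : ℝ) - m)) * expKernel a b c (n - 1 - k) := by
  have hδ : 0 ≤ δ := (norm_nonneg _).trans (hB 0)
  have hK := hG.const_nonneg
  have h1 : ‖G n (k + 1)‖ ≤ K * min (Real.exp (a * ((n - 1 - k : ℤ) : ℝ)))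
      (Real.exp (b * ((n - 1 - k : ℤ) : ℝ))) := by
    rw [mul_min_of_nonneg _ _ hK]
    refine le_min ((hG.bound_left n (k + 1)).trans_eq ?_)
      ((hG.bound_right n (k + 1)).trans_eq ?_) <;> · push_cast; ring_nf
  have h2 : Real.exp (c * ((k : ℝ) - m)) = Real.exp (c * ((n : ℝ) - m)) *
      Real.exp (-c * (((n - 1 - k : ℤ) : ℝ) + 1)) := by
    rw [← Real.exp_add]; push_cast; ring_nf
  calc ‖G n (k + 1) * B k‖ * Real.exp (c * ((k : ℝ) - m))
      ≤ (K * min (Real.exp (a * ((n - 1 - k : ℤ) : ℝ))) (Real.exp (b * ((n - 1 - k : ℤ) : ℝ))) * δ)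
        * Real.exp (c * ((k : ℝ) - m)) := by
        gcongr
        exact (norm_mul_le _ _).trans (mul_le_mul h1 (hB k) (norm_nonneg _) (by positivity))
    _ = _ := by rw [h2]; unfold expKernel; ring

theorem IsGreenKernel.summable_weighted (hG : IsGreenKernel A G a b K) {B : ℤ → R} {δ : ℝ}
    (hB : ∀ n, ‖B n‖ ≤ δ) {c : ℝ} (hac : a < c) (hcb : c < b) (n m : ℤ) :
    Summable fun k : ℤ => ‖G n (k + 1) * B k‖ * Real.exp (c * ((k : ℝ) - m)) := by
  refine Summable.of_nonneg_of_le (fun k => by positivity) (fun k => hG.weighted_le hB c n m k) ?_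
  exact (((Equiv.subLeft (n - 1)).summable_iff (f := expKernel a b c)).2
    (summable_expKernel hac hcb)).mul_left _

theorem IsGreenKernel.tsum_weighted_le (hG : IsGreenKernel A G a b K) {B : ℤ → R} {δ : ℝ}
    (hB : ∀ n, ‖B n‖ ≤ δ) {c : ℝ} (hac : a < c) (hcb : c < b) (n m : ℤ) :
    ∑' k : ℤ, ‖G n (k + 1) * B k‖ * Real.exp (c * ((k : ℝ) - m))
      ≤ K * δ * (∑' j, expKernel a b c j) * Real.exp (c * ((n : ℝ) - m)) := by
  have hs := ((Equiv.subLeft (n - 1)).summable_iff (f := expKernel a b c)).2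
    (summable_expKernel hac hcb)
  calc ∑' k : ℤ, ‖G n (k + 1) * B k‖ * Real.exp (c * ((k : ℝ) - m))
      ≤ ∑' k : ℤ, K * δ * Real.exp (c * ((n : ℝ) - m)) * expKernel a b c (n - 1 - k) :=
        (hG.summable_weighted hB hac hcb n m).tsum_le_tsum (fun k => hG.weighted_le hB c n m k)
          (hs.mul_left _)
    _ = K * δ * Real.exp (c * ((n : ℝ) - m)) * ∑' j, expKernel a b c j := by
        rw [tsum_mul_left, ← (Equiv.subLeft (n - 1)).tsum_eq (expKernel a b c)]
        rfl
    _ = _ := by ring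

end GreenKernel

/-! ### Perturbation of Green kernels -/

section GreenPerturbation

variable {R : Type*} [NormedRing R] {A : ℤ → R} {G : ℤ → ℤ → R} {a b K : ℝ}

theorem IsGreenKernel.summable_min (hG : IsGreenKernel A G a b K) {B : ℤ → R} {δ : ℝ}
    (hB : ∀ n, ‖B n‖ ≤ δ) {a' b' : ℝ} (ha : a < a') (hab : a' < b) (n m : ℤ) :
    Summable fun k : ℤ => ‖G n (k + 1) * B k‖ *
      min (Real.exp (a' * ((k : ℝ) - m))) (Real.exp (b' * ((k : ℝ) - m))) :=
  Summable.of_nonneg_of_le (fun k => by positivity)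
    (fun k => by gcongr; exact min_le_left _ _) (hG.summable_weighted hB ha hab n m)

/-- A contraction for two weights is one for their minimum. With this weight a single fixed point
carries both the forward and the backward bound. -/
theorem IsGreenKernel.tsum_min_le (hG : IsGreenKernel A G a b K) {B : ℤ → R} {δ : ℝ}
    (hB : ∀ n, ‖B n‖ ≤ δ) {a' b' C : ℝ} (ha : a < a') (hab : a' < b') (hb : b' < b)
    (hCa : ∑' j, expKernel a b a' j ≤ C) (hCb : ∑' j, expKernel a b b' j ≤ C) (n m : ℤ) :
    ∑' k : ℤ, ‖G n (k + 1) * B k‖ *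
        min (Real.exp (a' * ((k : ℝ) - m))) (Real.exp (b' * ((k : ℝ) - m)))
      ≤ K * δ * C * min (Real.exp (a' * ((n : ℝ) - m))) (Real.exp (b' * ((n : ℝ) - m))) := by
  have hδ : 0 ≤ δ := (norm_nonneg _).trans (hB 0)
  have hK := hG.const_nonneg
  have hC : 0 ≤ C := (tsum_nonneg (expKernel_nonneg a b a')).trans hCa
  have hs := hG.summable_min (b' := b') hB ha (hab.trans hb) n m
  rw [mul_min_of_nonneg _ _ (by positivity)]
  refine le_min ?_ ?_
  · refine (hs.tsum_le_tsum (fun k => ?_) (hG.summable_weighted hB ha (hab.trans hb) n m)).trans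
      ((hG.tsum_weighted_le hB ha (hab.trans hb) n m).trans ?_)
    · gcongr; exact min_le_left _ _
    · gcongr
  · refine (hs.tsum_le_tsum (fun k => ?_) (hG.summable_weighted hB (ha.trans hab) hb n m)).trans
      ((hG.tsum_weighted_le hB (ha.trans hab) hb n m).trans ?_)
    · gcongr; exact min_le_right _ _
    · gcongr

/-- The forward bound dominates both weakened weights when `n ≥ m`, the backward bound when `n ≤ m`.
-/
theorem IsGreenKernel.norm_le_min (hG : IsGreenKernel A G a b K) {a' b' : ℝ}
    (ha : a < a') (hab : a' < b') (hb : b' < b) (n m : ℤ) :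
    ‖G n m‖ ≤ K * min (Real.exp (a' * ((n : ℝ) - m))) (Real.exp (b' * ((n : ℝ) - m))) := by
  have hK := hG.const_nonneg
  rw [mul_min_of_nonneg _ _ hK]
  rcases le_total 0 ((n : ℝ) - m) with h | h
  · refine le_min ((hG.bound_left n m).trans ?_) ((hG.bound_left n m).trans ?_) <;>
      exact mul_le_mul_of_nonneg_left (Real.exp_le_exp.2
        (mul_le_mul_of_nonneg_right (by linarith) h)) hK
  · refine le_min ((hG.bound_right n m).trans ?_) ((hG.bound_right n m).trans ?_) <;>
      exact mul_le_mul_of_nonneg_left (Real.exp_le_exp.2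
        (mul_le_mul_of_nonpos_right (by linarith) h)) hK

/-- The integral equation for the perturbed Green kernel gives the forward difference equation. -/
theorem IsGreenKernel.succ_left_of_fixedPoint (hG : IsGreenKernel A G a b K) {B x : ℤ → R} {m : ℤ}
    (hs : ∀ n, Summable fun k => G n (k + 1) * B k * x k)
    (hx : ∀ n, x n = G n m + ∑' k, G n (k + 1) * B k * x k) (n : ℤ) :
    x (n + 1) = (A n + B n) * x n + if n + 1 = m then 1 else 0 := by
  -- The jump of `G` at `n + 1 = k + 1` contributes exactly one term, which is the perturbation `B n
  -- * x n`. This is why the kernel is evaluated at `k + 1`.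
  have hterm : ∀ k, G (n + 1) (k + 1) * B k * x k =
      A n * (G n (k + 1) * B k * x k) + if k = n then B n * x n else 0 := by
    intro k
    rw [hG.succ_left n (k + 1)]
    by_cases h : k = n
    · subst h; simp; noncomm_ring
    · rw [if_neg (by omega), if_neg h]; noncomm_ring
  rw [hx (n + 1), tsum_congr hterm,
    ((hs n).mul_left (A n)).tsum_add (hasSum_ite_eq n (B n * x n)).summable,
    tsum_ite_eq, (hs n).tsum_mul_left, hG.succ_left n m]
  conv_rhs => rw [add_mul, hx n, mul_add]
  rw [← hx n]
  abel

variable [CompleteSpace R]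

/-- The Green kernel of a perturbed difference equation. -/
theorem IsGreenKernel.exists_perturbation (hG : IsGreenKernel A G a b K) {B : ℤ → R} {δ : ℝ}
    (hB : ∀ n, ‖B n‖ ≤ δ) {a' b' C : ℝ} (ha : a < a') (hab : a' < b') (hb : b' < b)
    (hCa : ∑' j, expKernel a b a' j ≤ C) (hCb : ∑' j, expKernel a b b' j ≤ C)
    (hsmall : K * δ * C ≤ 1 / 2) :
    ∃ G' : ℤ → ℤ → R, IsGreenKernel (fun n => A n + B n) G' a' b' (2 * K) ∧
      (∀ n m : ℤ, ‖G' n m - G n m‖ ≤ 2 * K ^ 2 * C * δ * Real.exp (a' * ((n : ℝ) - m))) ∧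
      (∀ n m : ℤ, ‖G' n m - G n m‖ ≤ 2 * K ^ 2 * C * δ * Real.exp (b' * ((n : ℝ) - m))) := by
  have hδ : 0 ≤ δ := (norm_nonneg _).trans (hB 0)
  have hK := hG.const_nonneg
  have hC : 0 ≤ C := (tsum_nonneg (expKernel_nonneg a b a')).trans hCa
  have hθ0 : 0 ≤ K * δ * C := by positivity
  have hθ1 : K * δ * C < 1 := by linarith
  have hs := hG.summable_min (b' := b') hB ha (hab.trans hb)
  have hθ := hG.tsum_min_le hB ha hab hb hCa hCb
  have hinv : (1 - K * δ * C)⁻¹ ≤ 2 := by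
    rw [inv_le_comm₀ (by linarith) (by norm_num)]; linarith
  -- One equation is solved per column, so here `G'` takes the column index `m` first; the order is
  -- restored in the final witness.
  choose G' hfix hbound using fun m : ℤ =>
    exists_weighted_fixedPoint (L := fun n k => G n (k + 1) * B k)
      (w := fun n : ℤ => min (Real.exp (a' * ((n : ℝ) - m))) (Real.exp (b' * ((n : ℝ) - m))))
      (g := fun n => G n m) (fun n => by positivity) hθ0 hθ1 (fun n => hs n m) (fun n => hθ n m)
      hK (fun n => hG.norm_le_min ha hab hb n m)
  have hbound' : ∀ m n : ℤ, ‖G' m n‖ ≤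
      2 * K * min (Real.exp (a' * ((n : ℝ) - m))) (Real.exp (b' * ((n : ℝ) - m))) := fun m n =>
    (hbound m n).trans (by gcongr)
  have hsum : ∀ m n, Summable fun k => G n (k + 1) * B k * G' m k := fun m n =>
    summable_mul_of_weighted (fun n => hs n m) (hbound' m) n
  have hbl : ∀ n m : ℤ, ‖G' m n‖ ≤ 2 * K * Real.exp (a' * ((n : ℝ) - m)) := fun n m =>
    (hbound' m n).trans (by gcongr; exact min_le_left _ _)
  have hdiff : ∀ n m : ℤ, ‖G' m n - G n m‖ ≤ 2 * K ^ 2 * C * δ *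
      min (Real.exp (a' * ((n : ℝ) - m))) (Real.exp (b' * ((n : ℝ) - m))) := by
    intro n m
    rw [hfix m n, add_sub_cancel_left]
    refine (norm_tsum_mul_le_of_weighted (fun n => hs n m) (fun n => hθ n m) (by positivity)
      (hbound' m) n).trans_eq ?_
    ring
  have hleft : ∀ n m, G' m (n + 1) = (A n + B n) * G' m n + if n + 1 = m then 1 else 0 :=
    fun n m => hG.succ_left_of_fixedPoint (hsum m) (hfix m) n
  refine ⟨fun n m => G' m n, ⟨hleft, fun n m => ?_, hbl, fun n m => (hbound' m n).trans
    (by gcongr; exact min_le_right _ _)⟩, fun n m => (hdiff n m).trans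
    (by gcongr; exact min_le_left _ _), fun n m => (hdiff n m).trans
    (by gcongr; exact min_le_right _ _)⟩
  -- `D` is the defect in the equation for the second variable. It solves the homogeneous
  -- fixed-point equation and is bounded in one weight, hence vanishes.
  set D : ℤ → R := fun k => G' m k - G' (m + 1) k * (A m + B m) - if k = m then 1 else 0 with hD
  suffices h : D n = 0 by
    simp only [hD] at h
    rw [sub_sub] at h
    exact sub_eq_zero.1 h
  refine eq_zero_of_weighted_fixedPoint (L := fun n k => G n (k + 1) * B k)
    -- The bound `M` may depend on `‖A m + B m‖`, since `m` is fixed and uniqueness needs only some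
    -- finite bound.
    (w := fun n : ℤ => Real.exp (a' * ((n : ℝ) - m)))
    (M := 2 * K + 2 * K * Real.exp (-a') * ‖A m + B m‖ + ‖(1 : R)‖) hθ0 hθ1
    (fun n => hG.summable_weighted hB ha (hab.trans hb) n m)
    (fun n => (hG.tsum_weighted_le hB ha (hab.trans hb) n m).trans (by gcongr))
    (by positivity) (fun k => ?_) (fun k => ?_) n
  · have h1 : ‖G' (m + 1) k * (A m + B m)‖ ≤
        2 * K * Real.exp (-a') * ‖A m + B m‖ * Real.exp (a' * ((k : ℝ) - m)) := by
      refine (norm_mul_le _ _).trans ?_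
      calc ‖G' (m + 1) k‖ * ‖A m + B m‖
          ≤ (2 * K * Real.exp (a' * ((k : ℝ) - (m + 1 : ℤ)))) * ‖A m + B m‖ := by
            gcongr; exact hbl k (m + 1)
        _ = 2 * K * (Real.exp (-a') * Real.exp (a' * ((k : ℝ) - m))) * ‖A m + B m‖ := by
            rw [← Real.exp_add]; push_cast; ring_nf
        _ = _ := by ring
    have h2 : ‖(if k = m then 1 else 0 : R)‖ ≤ ‖(1 : R)‖ * Real.exp (a' * ((k : ℝ) - m)) := by
      split_ifs with h
      · simp [h]
      · rw [norm_zero]; positivity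
    calc ‖D k‖ ≤ ‖G' m k‖ + ‖G' (m + 1) k * (A m + B m)‖ + ‖(if k = m then 1 else 0 : R)‖ :=
          (norm_sub_le _ _).trans (add_le_add_left (norm_sub_le _ _) _)
      _ ≤ _ := by
          have := hbl k m
          linarith
  -- The delta term of `D` contributes `G k (m + 1) * B m`, which turns the factor `A m` from
  -- `succ_right` for `G` into `A m + B m`.
  · have hterm : ∀ j, G k (j + 1) * B j * D j = G k (j + 1) * B j * G' m j -
        G k (j + 1) * B j * G' (m + 1) j * (A m + B m) -
        if j = m then G k (m + 1) * B m else 0 := by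
      intro j
      by_cases h : j = m
      · subst h; simp [hD]; noncomm_ring
      · simp only [hD, if_neg h]; noncomm_ring
    have hfin : Summable fun j => if j = m then G k (m + 1) * B m else 0 :=
      (hasSum_ite_eq m (G k (m + 1) * B m)).summable
    have hmul := (hsum (m + 1) k).mul_right (A m + B m)
    rw [tsum_congr hterm, ((hsum m k).sub hmul).tsum_sub hfin,
      (hsum m k).tsum_sub hmul, tsum_ite_eq, (hsum (m + 1) k).tsum_mul_right]
    simp only [hD]
    rw [hfix m k, hfix (m + 1) k, hG.succ_right k m]
    noncomm_ring

end GreenPerturbation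

/-! ### Growth characterisation of the projectors and its algebraic consequences -/

section GreenConsequences

open Filter Topology

variable {R : Type*} [NormedRing R] {A : ℤ → R} {G : ℤ → ℤ → R} {a b K : ℝ}

theorem tendsto_mul_exp_natCast {c : ℝ} (hc : c < 0) (C : ℝ) :
    Tendsto (fun j : ℕ => C * Real.exp (c * j)) atTop (𝓝 0) := by
  rw [← mul_zero C]
  refine (Real.tendsto_exp_atBot.comp ?_).const_mul C
  exact tendsto_natCast_atTop_atTop.const_mul_atTop_of_neg hc

/-- A forward solution growing slower than the backward rate lies in the range of `G m m`. -/
theorem IsGreenKernel.mul_eq_self_of_forward (hG : IsGreenKernel A G a b K) {x : ℤ → R} {m : ℤ}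
    {c M : ℝ} (hx : ∀ k, m ≤ k → x (k + 1) = A k * x k)
    (hM : ∀ k : ℤ, m ≤ k → ‖x k‖ ≤ M * Real.exp (c * ((k : ℝ) - m))) (hc : c < b) :
    G m m * x m = x m := by
  have hK := hG.const_nonneg
  -- The pairing of row `m` of `G` with a solution is constant away from the diagonal. At infinity
  -- it tends to zero because `c < b`, and the jump across the diagonal is `x m`.
  have hconst : ∀ j : ℕ, G m (m + 1 + j) * x (m + 1 + j) = G m (m + 1) * x (m + 1) := by
    intro j
    induction j with
    | zero => simp
    | succ j ih =>
      rw [← ih, hG.succ_right m (m + 1 + j), if_neg (by omega), add_zero, mul_assoc,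
        ← hx (m + 1 + j) (by omega)]
      push_cast
      simp only [add_assoc]
  have hzero : G m (m + 1) * x (m + 1) = 0 := by
    refine norm_le_zero_iff.1 (ge_of_tendsto' (tendsto_mul_exp_natCast (sub_neg.2 hc)
      (K * M * Real.exp (c - b))) fun j => ?_)
    rw [← hconst j]
    refine (norm_mul_le _ _).trans ((mul_le_mul (hG.bound_right _ _) (hM (m + 1 + j) (by omega))
      (norm_nonneg _) (by positivity)).trans_eq ?_)
    calc _ = K * M * (Real.exp (b * ((m : ℝ) - (m + 1 + j : ℤ))) *
          Real.exp (c * (((m + 1 + j : ℤ) : ℝ) - m))) := by ring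
      _ = K * M * (Real.exp (c - b) * Real.exp ((c - b) * j)) := by
          rw [← Real.exp_add, ← Real.exp_add]; push_cast; ring_nf
      _ = _ := by ring
  rw [hG.succ_right m m, if_pos rfl, add_mul, mul_assoc, ← hx m le_rfl, hzero, zero_add, one_mul]

/-- A backward solution decaying faster than the forward rate lies in the kernel of `G m m`. -/
theorem IsGreenKernel.mul_eq_zero_of_backward (hG : IsGreenKernel A G a b K) {x : ℤ → R} {m : ℤ}
    {c M : ℝ} (hx : ∀ k, k < m → x (k + 1) = A k * x k)
    (hM : ∀ k : ℤ, k ≤ m → ‖x k‖ ≤ M * Real.exp (c * ((k : ℝ) - m))) (hc : a < c) :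
    G m m * x m = 0 := by
  have hK := hG.const_nonneg
  -- The same conserved pairing, followed into the past: no jump is crossed, and it tends to zero
  -- because `a < c`.
  have hconst : ∀ j : ℕ, G m (m - j) * x (m - j) = G m m * x m := by
    intro j
    induction j with
    | zero => simp
    | succ j ih =>
      have hj : m - ((j + 1 : ℕ) : ℤ) + 1 = m - j := by push_cast; ring
      rw [← ih, hG.succ_right m (m - (j + 1 : ℕ)), if_neg (by omega), add_zero, mul_assoc,
        ← hx (m - (j + 1 : ℕ)) (by omega), hj]
  refine norm_le_zero_iff.1 (ge_of_tendsto' (tendsto_mul_exp_natCast (sub_neg.2 hc)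
    (K * M)) fun j => ?_)
  rw [← hconst j]
  refine (norm_mul_le _ _).trans ((mul_le_mul (hG.bound_left _ _) (hM (m - j) (by omega))
    (norm_nonneg _) (by positivity)).trans_eq ?_)
  calc _ = K * M * (Real.exp (a * ((m : ℝ) - (m - j : ℤ))) *
        Real.exp (c * (((m - j : ℤ) : ℝ) - m))) := by ring
    _ = K * M * Real.exp ((a - c) * j) := by
        rw [← Real.exp_add]; push_cast; ring_nf

/-- Both sides equal `G (n + 1) n`, reached by a step in either variable. -/
theorem IsGreenKernel.commute (hG : IsGreenKernel A G a b K) (n : ℤ) :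
    A n * G n n = G (n + 1) (n + 1) * A n := by
  have h1 := hG.succ_left n n
  have h2 := hG.succ_right (n + 1) n
  rw [if_neg (by omega), add_zero] at h1 h2
  rw [← h1, ← h2]

variable {H : ℤ → ℤ → R} {a' b' K' : ℝ}

/-- From time `m` on, column `m` of `H` is a forward solution of rate `a'`. Taking `H = G` gives
idempotence; a second kernel gives nesting of ranges. -/
theorem IsGreenKernel.diag_mul_of_le (hG : IsGreenKernel A G a b K)
    (hH : IsGreenKernel A H a' b' K') (hab : a' < b) {n m : ℤ} (hnm : m ≤ n) :
    G n n * H n m = H n m := by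
  refine hG.mul_eq_self_of_forward (x := fun k => H k m) (c := a')
    (M := K' * Real.exp (a' * ((n : ℝ) - m))) (fun k hk => ?_) (fun k hk => ?_) hab
  · rw [hH.succ_left, if_neg (by omega), add_zero]
  · refine (hH.bound_left k m).trans_eq ?_
    rw [mul_assoc, ← Real.exp_add]; ring_nf

theorem IsGreenKernel.diag_mul_of_lt (hG : IsGreenKernel A G a b K)
    (hH : IsGreenKernel A H a' b' K') (hab : a < b') {n m : ℤ} (hnm : n < m) :
    G n n * H n m = 0 := by
  refine hG.mul_eq_zero_of_backward (x := fun k => H k m) (c := b')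
    (M := K' * Real.exp (b' * ((n : ℝ) - m))) (fun k hk => ?_) (fun k hk => ?_) hab
  · rw [hH.succ_left, if_neg (by omega), add_zero]
  · refine (hH.bound_right k m).trans_eq ?_
    rw [mul_assoc, ← Real.exp_add]; ring_nf

/-- The jump condition gives `1 - H n n = -A (n - 1) * H (n - 1) n`. Commuting `G` past `A (n - 1)`
reduces the claim to time `n - 1`, strictly before the diagonal. -/
theorem IsGreenKernel.diag_mul_compl (hG : IsGreenKernel A G a b K)
    (hH : IsGreenKernel A H a' b' K') (hab : a < b') (n : ℤ) :
    G n n * (1 - H n n) = 0 := by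
  have h1 := hH.succ_left (n - 1) n
  have h2 := hG.commute (n - 1)
  have h3 := hG.diag_mul_of_lt hH hab (sub_one_lt n)
  rw [sub_add_cancel] at h1 h2
  rw [if_pos rfl] at h1
  rw [h1, sub_add_cancel_right, mul_neg, ← mul_assoc, ← h2, mul_assoc, h3, mul_zero, neg_zero]

/-- The complementary part of a Green kernel, for use with `m ≤ n` as `backwardKernel G m n`. -/
def backwardKernel (G : ℤ → ℤ → R) (m n : ℤ) : R :=
  (if m = n then 1 else 0) - G m n

theorem backwardKernel_self (G : ℤ → ℤ → R) (n : ℤ) : backwardKernel G n n = 1 - G n n := by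
  simp [backwardKernel]

theorem backwardKernel_of_lt (G : ℤ → ℤ → R) {m n : ℤ} (h : m < n) :
    backwardKernel G m n = -G m n := by
  simp [backwardKernel, h.ne]

theorem IsGreenKernel.mul_backwardKernel (hG : IsGreenKernel A G a b K) {k n : ℤ} (h : k < n) :
    A k * backwardKernel G k n = backwardKernel G (k + 1) n := by
  unfold backwardKernel
  rw [if_neg h.ne, hG.succ_left k n]
  simp

theorem IsGreenKernel.backwardKernel_mul (hG : IsGreenKernel A G a b K) {k n : ℤ} (h : k ≤ n) :
    backwardKernel G k (n + 1) * A n = backwardKernel G k n := by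
  unfold backwardKernel
  rw [if_neg (by omega), hG.succ_right k n]
  simp

theorem IsGreenKernel.diag_mul_backwardKernel (hG : IsGreenKernel A G a b K)
    (hH : IsGreenKernel A H a' b' K') (hab : a < b') {n m : ℤ} (hnm : n ≤ m) :
    G n n * backwardKernel H n m = 0 := by
  rcases hnm.eq_or_lt with rfl | h
  · rw [backwardKernel_self, hG.diag_mul_compl hH hab]
  · rw [backwardKernel_of_lt _ h, mul_neg, hG.diag_mul_of_lt hH hab h, neg_zero]

end GreenConsequences

/-! ### Evolution operators and their inverses on the parts -/

section EvolutionLemmas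

variable {𝕜 : Type*} [RCLike 𝕜] {Y : Type*} [NormedAddCommGroup Y] [NormedSpace 𝕜 Y]
  {A : ℤ → Y →L[𝕜] Y} {P : ℤ → Y →L[𝕜] Y}

theorem evolutionSteps_succ_right (A : ℤ → Y →L[𝕜] Y) (m : ℤ) (k : ℕ) :
    evolutionSteps A m (k + 1) = evolutionSteps A (m + 1) k * A m := by
  induction k with
  | zero => simp [evolutionSteps, ContinuousLinearMap.mul_def]
  | succ k ih =>
    have h : m + ((k + 1 : ℕ) : ℤ) = m + 1 + k := by push_cast; ring
    rw [evolutionSteps, ih, evolutionSteps, h]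
    rfl

theorem evolution_self (A : ℤ → Y →L[𝕜] Y) (n : ℤ) : evolution A n n = 1 := by
  simp [evolution, evolutionSteps, ContinuousLinearMap.one_def]

theorem evolution_succ_left (A : ℤ → Y →L[𝕜] Y) {n m : ℤ} (h : m ≤ n) :
    evolution A (n + 1) m = A n * evolution A n m := by
  obtain ⟨k, rfl⟩ := Int.le.dest h
  have h1 : (m + k + 1 - m).toNat = k + 1 := by omega
  have h2 : (m + k - m).toNat = k := by omega
  rw [evolution, evolution, h1, h2]
  rfl

theorem evolution_succ_right (A : ℤ → Y →L[𝕜] Y) {n m : ℤ} (h : m < n) :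
    evolution A n m = evolution A n (m + 1) * A m := by
  obtain ⟨k, rfl⟩ := Int.le.dest (Int.add_one_le_of_lt h)
  have h1 : (m + 1 + k - m).toNat = k + 1 := by omega
  have h2 : (m + 1 + k - (m + 1)).toNat = k := by omega
  rw [evolution, evolution, h1, h2, evolutionSteps_succ_right]

theorem partEvolution_of_le (A P : ℤ → Y →L[𝕜] Y) {n m : ℤ} (h : m ≤ n) :
    partEvolution A P n m = P n * evolution A n m := by
  rw [partEvolution, if_pos h]; rfl

/-- The evolution carries a solution at time `m` to its value at time `n`. -/
theorem evolution_mul_eq_of_step {x : ℤ → Y →L[𝕜] Y} {n m : ℤ} (h : m ≤ n)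
    (hx : ∀ k, m ≤ k → k < n → A k * x k = x (k + 1)) : evolution A n m * x m = x n := by
  induction n, h using Int.leInduction with
  | base => rw [evolution_self, one_mul]
  | succ n hmn ih =>
    rw [evolution_succ_left A hmn, mul_assoc, ih fun k h1 h2 => hx k h1 (by omega),
      hx n hmn (by omega)]

theorem mul_evolution_eq_of_step {x : ℤ → Y →L[𝕜] Y} {n m : ℤ} (h : m ≤ n)
    (hx : ∀ k, m ≤ k → k < n → x (k + 1) * A k = x k) : x n * evolution A n m = x m := by
  induction n, h using Int.leInduction with
  | base => rw [evolution_self, mul_one]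
  | succ n hmn ih =>
    rw [evolution_succ_left A hmn, ← mul_assoc, hx n hmn (by omega),
      ih fun k h1 h2 => hx k h1 (by omega)]

/-- An operator inverting the evolution modulo the projectors `P` is the part evolution backward
in time. -/
theorem partEvolution_eq_of_inverse {n m : ℤ} {W : Y →L[𝕜] Y} (h : m ≤ n)
    (hP : P n * evolution A n m = evolution A n m * P m)
    (h1 : evolution A n m * W = P n) (h2 : W * evolution A n m = P m) (h3 : P m * W = W) :
    (evolutionOnRange A P n m).IsInvertible ∧ partEvolution A P m n = W := by
  have hPm : P m * P m = P m := by rw [← h2, ← mul_assoc, h2, h3, h2]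
  have hPn : P n * P n = P n := by
    rw [← h1, mul_assoc, ← mul_assoc W, h2, h3]
  have h4 : W * P n = W := by rw [← h1, ← mul_assoc, h2, h3]
  have h3' : ∀ y, P m (W y) = W y := fun y => congrArg (fun T : Y →L[𝕜] Y => T y) h3
  have hPm' : ∀ y : (P m).range, P m (y : Y) = y := by
    rintro ⟨_, z, rfl⟩
    exact congrArg (fun T : Y →L[𝕜] Y => T z) hPm
  have hPn' : ∀ y : (P n).range, P n (y : Y) = y := by
    rintro ⟨_, z, rfl⟩
    exact congrArg (fun T : Y →L[𝕜] Y => T z) hPn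
  let V : (P n).range →L[𝕜] (P m).range :=
    (W.comp (P n).range.subtypeL).codRestrict (P m).range fun y => ⟨W y, h3' y⟩
  let e : (P m).range ≃L[𝕜] (P n).range := ContinuousLinearEquiv.equivOfInverse
    (evolutionOnRange A P n m) V
    (fun y => Subtype.ext (by
      have : (W * (P n * evolution A n m)) y = (P m) y := by
        rw [← mul_assoc, h4, h2]
      exact this.trans (hPm' y)))
    (fun y => Subtype.ext (by
      have : (P n * (evolution A n m * W)) y = P n y := by rw [h1, hPn]
      exact this.trans (hPn' y)))
  have he : (e : (P m).range →L[𝕜] (P n).range) = evolutionOnRange A P n m := rfl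
  refine ⟨⟨e, he⟩, ?_⟩
  -- On the diagonal `partEvolution` takes its forward branch, so the inverse formula does not apply
  -- there.
  rcases h.eq_or_lt with rfl | hlt
  · rw [partEvolution_of_le A P le_rfl, evolution_self, mul_one]
    rw [evolution_self, one_mul] at h1
    exact h1.symm
  · rw [partEvolution, if_neg (by omega), ← he, ContinuousLinearMap.inverse_equiv]
    ext y
    exact congrArg (fun T : Y →L[𝕜] Y => T y) h4

/-- The algebraic relations of the backward part evolution. -/
theorem partEvolution_inverse {n m : ℤ} (h : m ≤ n) (hPm : P m * P m = P m)
    (hP : P n * evolution A n m = evolution A n m * P m)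
    (hinv : (evolutionOnRange A P n m).IsInvertible) :
    evolution A n m * partEvolution A P m n = P n ∧
      partEvolution A P m n * evolution A n m = P m ∧
      P m * partEvolution A P m n = partEvolution A P m n ∧
      partEvolution A P m n * P n = partEvolution A P m n := by
  obtain ⟨e, he⟩ := hinv
  rcases h.eq_or_lt with rfl | hlt
  · rw [partEvolution_of_le A P le_rfl, evolution_self]
    simp [hPm]
  have hPm' : ∀ y : (P m).range, P m (y : Y) = y := by
    rintro ⟨_, z, rfl⟩
    exact congrArg (fun T : Y →L[𝕜] Y => T z) hPm
  have heval : ∀ y : (P m).range, (e y : Y) = evolution A n m y := by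
    intro y
    have h1 : (e y : Y) = (P n * evolution A n m) y := congrArg
      (fun T : (P m).range →L[𝕜] (P n).range => (T y : Y)) he
    rw [h1, hP]
    exact congrArg (evolution A n m) (hPm' y)
  have hW : ∀ y, partEvolution A P m n y = e.symm ⟨P n y, y, rfl⟩ := by
    intro y
    rw [partEvolution, if_neg (by omega), ← he, ContinuousLinearMap.inverse_equiv]
    rfl
  have hUW : evolution A n m * partEvolution A P m n = P n := by
    ext y
    change evolution A n m (partEvolution A P m n y) = P n y
    rw [hW, ← heval, e.apply_symm_apply]
  have hWU : partEvolution A P m n * evolution A n m = P m := by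
    ext y
    change partEvolution A P m n (evolution A n m y) = P m y
    rw [hW]
    have : (⟨P n (evolution A n m y), _, rfl⟩ : (P n).range) = e ⟨P m y, y, rfl⟩ :=
      Subtype.ext ((congrArg (fun T : Y →L[𝕜] Y => T y) hP).trans (heval ⟨P m y, y, rfl⟩).symm)
    rw [this, e.symm_apply_apply]
  have hPW : P m * partEvolution A P m n = partEvolution A P m n := by
    ext y
    change P m (partEvolution A P m n y) = _
    rw [hW, hPm']
  exact ⟨hUW, hWU, hPW, by rw [← hUW, ← mul_assoc, hWU, hPW]⟩

/-- The backward part evolution solves the difference equation in both arguments. -/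
theorem partEvolution_backward_step (hPP : ∀ n, P n * P n = P n)
    (hP : ∀ n m, m ≤ n → P n * evolution A n m = evolution A n m * P m)
    (hinv : ∀ n m, m ≤ n → (evolutionOnRange A P n m).IsInvertible) :
    (∀ k n, k < n → A k * partEvolution A P k n = partEvolution A P (k + 1) n) ∧
      ∀ k n, k ≤ n → partEvolution A P k (n + 1) * A n = partEvolution A P k n := by
  have hstep : ∀ n, P (n + 1) * A n = A n * P n := by
    intro n
    have := hP (n + 1) n (by omega)
    rwa [evolution_succ_left A le_rfl, evolution_self, mul_one] at this
  have hrel := fun n m (h : m ≤ n) => partEvolution_inverse h (hPP m) (hP n m h) (hinv n m h)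
  constructor
  · intro k n h
    obtain ⟨h1, -, h3, -⟩ := hrel n k h.le
    obtain ⟨-, k2, -, k4⟩ := hrel n (k + 1) h
    rw [evolution_succ_right A h] at h1
    calc A k * partEvolution A P k n = A k * (P k * partEvolution A P k n) := by rw [h3]
      _ = P (k + 1) * A k * partEvolution A P k n := by rw [← mul_assoc, hstep]
      _ = partEvolution A P (k + 1) n *
          (evolution A n (k + 1) * A k * partEvolution A P k n) := by
          rw [← k2]; simp only [mul_assoc]
      _ = _ := by rw [h1, k4]
  · intro k n h
    obtain ⟨h1, -, h3, -⟩ := hrel n k h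
    obtain ⟨-, k2, -, k4⟩ := hrel (n + 1) k (by omega)
    rw [evolution_succ_left A h] at k2
    calc partEvolution A P k (n + 1) * A n
        = partEvolution A P k (n + 1) * P (n + 1) * A n := by rw [k4]
      _ = partEvolution A P k (n + 1) * A n * P n := by
          rw [mul_assoc, hstep, mul_assoc]
      _ = partEvolution A P k (n + 1) * (A n * evolution A n k) * partEvolution A P k n := by
          rw [← h1]; simp only [mul_assoc]
      _ = _ := by rw [k2, h3]

end EvolutionLemmas

/-! ### Gluing forward and backward evolutions into a Green kernel -/

section GluedKernel

variable {R : Type*} [NormedRing R] {A : ℤ → R} {F V : ℤ → ℤ → R} {a b K : ℝ}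

/-- The kernel equal to `F` forward in time and to `-V` backward in time. -/
def gluedKernel (F V : ℤ → ℤ → R) (n m : ℤ) : R :=
  if m ≤ n then F n m else -V n m

/-- The change of sign makes the jump across the diagonal equal to `F n n + V n n = 1`. Each part
also obeys the other part's bound, since `a ≤ b`. -/
theorem isGreenKernel_gluedKernel (hK : 0 ≤ K) (hab : a ≤ b)
    (hF : ∀ n m, m ≤ n → A n * F n m = F (n + 1) m)
    (hF' : ∀ n m, m < n → F n (m + 1) * A m = F n m)
    (hV : ∀ k n, k < n → A k * V k n = V (k + 1) n)
    (hV' : ∀ k n, k ≤ n → V k (n + 1) * A n = V k n)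
    (hsum : ∀ n, F n n + V n n = 1)
    (hFb : ∀ n m : ℤ, m ≤ n → ‖F n m‖ ≤ K * Real.exp (a * ((n : ℝ) - m)))
    (hVb : ∀ n m : ℤ, n ≤ m → ‖V n m‖ ≤ K * Real.exp (b * ((n : ℝ) - m))) :
    IsGreenKernel A (gluedKernel F V) a b K where
  succ_left n m := by
    unfold gluedKernel
    rcases lt_trichotomy (n + 1) m with h | rfl | h
    · rw [if_neg (by omega), if_neg (by omega), if_neg h.ne, mul_neg, hV n m (by omega), add_zero]
    · rw [if_pos le_rfl, if_neg (by omega), if_pos rfl, mul_neg, hV n _ (by omega),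
        ← hsum (n + 1)]
      abel
    · rw [if_pos h.le, if_pos (by omega), if_neg h.ne', hF n m (by omega), add_zero]
  succ_right n m := by
    unfold gluedKernel
    rcases lt_trichotomy n m with h | rfl | h
    · rw [if_neg (by omega), if_neg (by omega), if_neg h.ne, neg_mul, hV' n m h.le, add_zero]
    · rw [if_pos le_rfl, if_neg (by omega), if_pos rfl, neg_mul, hV' n n le_rfl, ← hsum n]
      abel
    · rw [if_pos h.le, if_pos (by omega), if_neg h.ne', hF' n m h, add_zero]
  bound_left n m := by
    unfold gluedKernel
    split_ifs with h
    · exact hFb n m h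
    · rw [norm_neg]
      have h' : (n : ℝ) - m ≤ 0 := by
        have : (n : ℝ) ≤ m := by exact_mod_cast (not_le.1 h).le
        linarith
      exact (hVb n m (not_le.1 h).le).trans (mul_le_mul_of_nonneg_left (Real.exp_le_exp.2
        (mul_le_mul_of_nonpos_right hab h')) hK)
  bound_right n m := by
    unfold gluedKernel
    split_ifs with h
    · have h' : 0 ≤ (n : ℝ) - m := by
        have : (m : ℝ) ≤ n := by exact_mod_cast h
        linarith
      exact (hFb n m h).trans (mul_le_mul_of_nonneg_left (Real.exp_le_exp.2
        (mul_le_mul_of_nonneg_right hab h')) hK)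
    · rw [norm_neg]
      exact hVb n m (not_le.1 h).le

end GluedKernel

/-! ### Trichotomies and pairs of Green kernels -/

section Trichotomy

variable {𝕜 : Type*} [RCLike 𝕜] {Y : Type*} [NormedAddCommGroup Y] [NormedSpace 𝕜 Y]
  {A : ℤ → Y →L[𝕜] Y} {κ ρ₀ ρ : ℝ} {P : TrichotomyPart → ℤ → Y →L[𝕜] Y}

theorem partEvolution_forward_step {P : ℤ → Y →L[𝕜] Y}
    (hP : ∀ n m, m ≤ n → P n * evolution A n m = evolution A n m * P m) :
    (∀ n m, m ≤ n → A n * partEvolution A P n m = partEvolution A P (n + 1) m) ∧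
      ∀ n m, m < n → partEvolution A P n (m + 1) * A m = partEvolution A P n m := by
  constructor
  · intro n m h
    rw [partEvolution_of_le A P h, partEvolution_of_le A P (h.trans (Int.le_add_one le_rfl)),
      hP n m h, hP (n + 1) m (by omega), evolution_succ_left A h, mul_assoc]
  · intro n m h
    rw [partEvolution_of_le A P h.le, partEvolution_of_le A P (Int.add_one_le_of_lt h),
      evolution_succ_right A h, mul_assoc]

theorem partEvolution_mul_of_le {P : ℤ → Y →L[𝕜] Y} {n m : ℤ} (h : m ≤ n)
    (hPP : P m * P m = P m) (hP : P n * evolution A n m = evolution A n m * P m) :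
    partEvolution A P n m * P m = partEvolution A P n m := by
  rw [partEvolution_of_le A P h, hP, mul_assoc, hPP]

theorem norm_le_of_apply_projector {T Q : Y →L[𝕜] Y} {C : ℝ} (hC : 0 ≤ C) (hT : T * Q = T)
    (h : ∀ y, ‖T (Q y)‖ ≤ C * ‖y‖) : ‖T‖ ≤ C :=
  T.opNorm_le_bound hC fun y => by
    have : T (Q y) = T y := congrArg (fun S : Y →L[𝕜] Y => S y) hT
    exact this ▸ h y

namespace HasExpTrichotomy

theorem projector_mul (h : HasExpTrichotomy A κ ρ₀ ρ P) (a : TrichotomyPart) (n : ℤ) :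
    P a n * P a n = P a n := h.projector a n

theorem commute_mul (h : HasExpTrichotomy A κ ρ₀ ρ P) (a : TrichotomyPart) (n m : ℤ)
    (hnm : m ≤ n) : P a n * evolution A n m = evolution A n m * P a m := h.commute a n m hnm

theorem norm_stable_le (h : HasExpTrichotomy A κ ρ₀ ρ P) (hκ : 0 ≤ κ) {n m : ℤ} (hnm : m ≤ n) :
    ‖partEvolution A (P .stable) n m‖ ≤ κ * Real.exp (-ρ * ((n : ℝ) - m)) :=
  norm_le_of_apply_projector (by positivity)
    (partEvolution_mul_of_le hnm (h.projector_mul _ _) (h.commute_mul _ _ _ hnm))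
    fun y => h.stable_bound y n m hnm

theorem norm_unstable_le (h : HasExpTrichotomy A κ ρ₀ ρ P) (hκ : 0 ≤ κ) {n m : ℤ}
    (hnm : m ≤ n) :
    ‖partEvolution A (P .unstable) m n‖ ≤ κ * Real.exp (-ρ * ((n : ℝ) - m)) :=
  norm_le_of_apply_projector (by positivity)
    (partEvolution_inverse hnm (h.projector_mul _ _) (h.commute_mul _ _ _ hnm)
      (h.invertible_unstable n m hnm)).2.2.2
    fun y => h.unstable_bound y n m hnm

theorem norm_central_le (h : HasExpTrichotomy A κ ρ₀ ρ P) (hκ : 0 ≤ κ) (n m : ℤ) :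
    ‖partEvolution A (P .central) n m‖ ≤ κ * Real.exp (ρ₀ * |(n : ℝ) - m|) := by
  refine norm_le_of_apply_projector (Q := P .central m) (by positivity) ?_
    fun y => h.central_bound y n m
  rcases le_total m n with hnm | hnm
  · exact partEvolution_mul_of_le hnm (h.projector_mul _ _) (h.commute_mul _ _ _ hnm)
  · exact (partEvolution_inverse hnm (h.projector_mul _ _) (h.commute_mul _ _ _ hnm)
      (h.invertible_central m n hnm)).2.2.2

/-- The Green kernel separating the stable part from the central and unstable parts. -/
theorem isGreenKernel_stable (h : HasExpTrichotomy A κ ρ₀ ρ P) (hκ : 0 ≤ κ) :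
    IsGreenKernel A (gluedKernel (partEvolution A (P .stable)) fun n m =>
      partEvolution A (P .central) n m + partEvolution A (P .unstable) n m) (-ρ) (-ρ₀) (2 * κ) := by
  have hs := partEvolution_forward_step (h.commute_mul .stable)
  have hc := partEvolution_backward_step (h.projector_mul .central) (h.commute_mul .central)
    h.invertible_central
  have hu := partEvolution_backward_step (h.projector_mul .unstable) (h.commute_mul .unstable)
    h.invertible_unstable
  have hlt := h.exponent_lt
  have hpos := h.exponent_pos
  refine isGreenKernel_gluedKernel (by positivity) (by linarith) hs.1 hs.2
    (fun k n hkn => ?_) (fun k n hkn => ?_) (fun n => ?_) (fun n m hnm => ?_) (fun n m hnm => ?_)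
  · rw [mul_add, hc.1 k n hkn, hu.1 k n hkn]
  · rw [add_mul, hc.2 k n hkn, hu.2 k n hkn]
  · simp only [partEvolution_of_le A _ (le_refl n), evolution_self, mul_one]
    rw [ContinuousLinearMap.one_def, ← h.sum_eq_id n]
    abel
  · refine (h.norm_stable_le hκ hnm).trans ?_
    gcongr
    linarith
  · have hnm' : (n : ℝ) - m ≤ 0 := by
      have : (n : ℝ) ≤ m := by exact_mod_cast hnm
      linarith
    have h1 := h.norm_central_le hκ n m
    have h2 := h.norm_unstable_le hκ hnm
    rw [abs_of_nonpos hnm'] at h1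
    have h3 : κ * Real.exp (-ρ * ((m : ℝ) - n)) ≤ κ * Real.exp (ρ₀ * -((n : ℝ) - m)) := by
      gcongr <;> linarith
    -- Central and unstable parts each contribute `κ`, hence the kernel constant `2 * κ`.
    calc _ ≤ κ * Real.exp (ρ₀ * -((n : ℝ) - m)) + κ * Real.exp (ρ₀ * -((n : ℝ) - m)) :=
          (norm_add_le _ _).trans (add_le_add h1 (h2.trans h3))
      _ = _ := by rw [mul_neg, ← neg_mul]; ring

/-- The Green kernel separating the stable and central parts from the unstable part. -/
theorem isGreenKernel_unstable (h : HasExpTrichotomy A κ ρ₀ ρ P) (hκ : 0 ≤ κ) :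
    IsGreenKernel A (gluedKernel (fun n m =>
      partEvolution A (P .stable) n m + partEvolution A (P .central) n m)
      (partEvolution A (P .unstable))) ρ₀ ρ (2 * κ) := by
  have hs := partEvolution_forward_step (h.commute_mul .stable)
  have hc := partEvolution_forward_step (h.commute_mul .central)
  have hu := partEvolution_backward_step (h.projector_mul .unstable) (h.commute_mul .unstable)
    h.invertible_unstable
  have hlt := h.exponent_lt
  have hpos := h.exponent_pos
  refine isGreenKernel_gluedKernel (by positivity) (by linarith)
    (fun k n hkn => ?_) (fun k n hkn => ?_) hu.1 hu.2 (fun n => ?_) (fun n m hnm => ?_)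
    (fun n m hnm => ?_)
  · rw [mul_add, hs.1 k n hkn, hc.1 k n hkn]
  · rw [add_mul, hs.2 k n hkn, hc.2 k n hkn]
  · simp only [partEvolution_of_le A _ (le_refl n), evolution_self, mul_one]
    rw [ContinuousLinearMap.one_def, ← h.sum_eq_id n]
    abel
  · have hnm' : 0 ≤ (n : ℝ) - m := by
      have : (m : ℝ) ≤ n := by exact_mod_cast hnm
      linarith
    have h1 := h.norm_central_le hκ n m
    have h2 := h.norm_stable_le hκ hnm
    rw [abs_of_nonneg hnm'] at h1
    have h3 : κ * Real.exp (-ρ * ((n : ℝ) - m)) ≤ κ * Real.exp (ρ₀ * ((n : ℝ) - m)) := by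
      gcongr
      linarith
    calc _ ≤ κ * Real.exp (ρ₀ * ((n : ℝ) - m)) + κ * Real.exp (ρ₀ * ((n : ℝ) - m)) :=
          (norm_add_le _ _).trans (add_le_add (h2.trans h3) h1)
      _ = _ := by ring
  · refine (h.norm_unstable_le hκ hnm).trans ?_
    have : -ρ * ((m : ℝ) - n) = ρ * ((n : ℝ) - m) := by ring
    rw [this]
    gcongr
    linarith

end HasExpTrichotomy

/-- The projectors of the trichotomy described by two Green kernels. -/
def trichotomyProj (G H : ℤ → ℤ → Y →L[𝕜] Y) : TrichotomyPart → ℤ → Y →L[𝕜] Y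
  | .stable, n => G n n
  | .unstable, n => 1 - H n n
  | .central, n => H n n - G n n

/-- An exponential trichotomy is described by two Green kernels. -/
theorem HasExpTrichotomy.exists_isGreenKernel (h : HasExpTrichotomy A κ ρ₀ ρ P) (hκ : 0 ≤ κ) :
    ∃ G H : ℤ → ℤ → Y →L[𝕜] Y, IsGreenKernel A G (-ρ) (-ρ₀) (2 * κ) ∧
      IsGreenKernel A H ρ₀ ρ (2 * κ) ∧ P = trichotomyProj G H := by
  refine ⟨_, _, h.isGreenKernel_stable hκ, h.isGreenKernel_unstable hκ, ?_⟩
  funext a n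
  have hsum : P .stable n + P .unstable n + P .central n = 1 := h.sum_eq_id n
  cases a <;> simp only [trichotomyProj, gluedKernel, le_refl, if_true,
    partEvolution_of_le A _ (le_refl n), evolution_self, mul_one]
  · abel
  · rw [← hsum]; abel

variable {G H : ℤ → ℤ → Y →L[𝕜] Y} {a b a' b' K K' : ℝ}

theorem IsGreenKernel.diag_mul_evolution (hG : IsGreenKernel A G a b K) {n m : ℤ} (h : m ≤ n) :
    G n n * evolution A n m = G n m :=
  mul_evolution_eq_of_step (x := fun k => G n k) h fun k _ hk => by
    rw [hG.succ_right n k, if_neg (by omega), add_zero]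

theorem IsGreenKernel.commute_evolution (hG : IsGreenKernel A G a b K) {n m : ℤ} (h : m ≤ n) :
    G n n * evolution A n m = evolution A n m * G m m := by
  rw [hG.diag_mul_evolution h]
  exact (evolution_mul_eq_of_step (x := fun k => G k m) h fun k hk _ => by
    rw [hG.succ_left k m, if_neg (by omega), add_zero]).symm

theorem IsGreenKernel.evolution_mul_backwardKernel (hG : IsGreenKernel A G a b K) {n m : ℤ}
    (h : m ≤ n) : evolution A n m * backwardKernel G m n = 1 - G n n := by
  rw [← backwardKernel_self]
  exact evolution_mul_eq_of_step (x := fun k => backwardKernel G k n) h fun k _ hk =>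
    hG.mul_backwardKernel hk

theorem IsGreenKernel.backwardKernel_mul_evolution (hG : IsGreenKernel A G a b K) {n m : ℤ}
    (h : m ≤ n) : backwardKernel G m n * evolution A n m = 1 - G m m := by
  rw [← backwardKernel_self]
  exact mul_evolution_eq_of_step (x := fun k => backwardKernel G m k) h fun k hk _ =>
    hG.backwardKernel_mul hk

theorem IsGreenKernel.commute_trichotomyProj (hG : IsGreenKernel A G a b K)
    (hH : IsGreenKernel A H a' b' K') (t : TrichotomyPart) {n m : ℤ} (h : m ≤ n) :
    trichotomyProj G H t n * evolution A n m = evolution A n m * trichotomyProj G H t m := by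
  cases t <;> simp only [trichotomyProj, sub_mul, mul_sub, one_mul, mul_one,
    hG.commute_evolution h, hH.commute_evolution h]

theorem IsGreenKernel.partEvolution_stable (hG : IsGreenKernel A G a b K) {n m : ℤ} (h : m ≤ n) :
    partEvolution A (trichotomyProj G H .stable) n m = G n m := by
  rw [partEvolution_of_le _ _ h]
  exact hG.diag_mul_evolution h

theorem IsGreenKernel.partEvolution_central (hG : IsGreenKernel A G a b K)
    (hH : IsGreenKernel A H a' b' K') {n m : ℤ} (h : m ≤ n) :
    partEvolution A (trichotomyProj G H .central) n m = H n m - G n m := by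
  rw [partEvolution_of_le _ _ h, trichotomyProj, sub_mul, hG.diag_mul_evolution h,
    hH.diag_mul_evolution h]

/-- The backward part of `H` inverts the evolution modulo `1 - H`, by transporting its columns and
rows to the diagonal. -/
theorem IsGreenKernel.unstable_backward (hG : IsGreenKernel A G a b K)
    (hH : IsGreenKernel A H a' b' K') (hab : a' < b') {n m : ℤ} (h : m ≤ n) :
    (evolutionOnRange A (trichotomyProj G H .unstable) n m).IsInvertible ∧
      partEvolution A (trichotomyProj G H .unstable) m n = backwardKernel H m n :=
  partEvolution_eq_of_inverse h (hG.commute_trichotomyProj hH .unstable h)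
    (hH.evolution_mul_backwardKernel h) (hH.backwardKernel_mul_evolution h) (by
      rw [trichotomyProj, sub_mul, one_mul, hH.diag_mul_backwardKernel hH hab h, sub_zero])

/-- Compatibility relations of the projectors of two Green kernels with ordered rates. -/
theorem IsGreenKernel.diag_relations (hG : IsGreenKernel A G a b K)
    (hH : IsGreenKernel A H a' b' K') (h1 : a < b) (h2 : a' < b') (h3 : a < b') (n : ℤ) :
    G n n * G n n = G n n ∧ H n n * H n n = H n n ∧ H n n * G n n = G n n ∧
      G n n * H n n = G n n := by
  refine ⟨hG.diag_mul_of_le hG h1 le_rfl, hH.diag_mul_of_le hH h2 le_rfl,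
    hH.diag_mul_of_le hG h3 le_rfl, ?_⟩
  have := hG.diag_mul_compl hH h3 n
  rw [mul_sub, mul_one, sub_eq_zero] at this
  exact this.symm

theorem IsGreenKernel.central_backward (hG : IsGreenKernel A G a b K)
    (hH : IsGreenKernel A H a' b' K') (h1 : a < b) (h2 : a' < b') (h3 : a < b') {n m : ℤ}
    (h : m ≤ n) :
    (evolutionOnRange A (trichotomyProj G H .central) n m).IsInvertible ∧
      partEvolution A (trichotomyProj G H .central) m n =
        backwardKernel G m n - backwardKernel H m n := by
  refine partEvolution_eq_of_inverse h (hG.commute_trichotomyProj hH .central h) ?_ ?_ ?_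
  · rw [mul_sub, hG.evolution_mul_backwardKernel h, hH.evolution_mul_backwardKernel h,
      trichotomyProj]
    abel
  · rw [sub_mul, hG.backwardKernel_mul_evolution h, hH.backwardKernel_mul_evolution h,
      trichotomyProj]
    abel
  · have e1 : G m m * backwardKernel G m n = 0 := hG.diag_mul_backwardKernel hG h1 h
    have e2 : H m m * backwardKernel H m n = 0 := hH.diag_mul_backwardKernel hH h2 h
    have e3 : G m m * backwardKernel H m n = 0 := hG.diag_mul_backwardKernel hH h3 h
    -- Compressing the central-unstable inverse to the unstable part gives the unstable inverse:
    -- write `1 - H m m` as `backwardKernel H m n * evolution A n m`, then use `(1 - H n n) * (1 - G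
    -- n n) = 1 - H n n`.
    have e4 : (1 - H m m) * backwardKernel G m n = backwardKernel H m n := by
      obtain ⟨-, -, r3, -⟩ := hG.diag_relations hH h1 h2 h3 n
      have hHn : backwardKernel H m n * (1 - H n n) = backwardKernel H m n := by
        rw [← hH.evolution_mul_backwardKernel h, ← mul_assoc, hH.backwardKernel_mul_evolution h,
          sub_mul, one_mul, e2, sub_zero]
      have hprod : (1 - H n n) * (1 - G n n) = 1 - H n n := by
        rw [sub_mul, one_mul, mul_sub, mul_one, r3]; abel
      rw [← hH.backwardKernel_mul_evolution h, mul_assoc, hG.evolution_mul_backwardKernel h]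
      rw [← hHn, mul_assoc, hprod, hHn]
    rw [sub_mul, one_mul] at e4
    rw [trichotomyProj, sub_mul, mul_sub, mul_sub, e1, e2, e3]
    have e5 : H m m * backwardKernel G m n = backwardKernel G m n - backwardKernel H m n := by
      rw [← e4]; abel
    rw [e5]; abel

/-- Two Green kernels with ordered rates describe an exponential trichotomy. -/
theorem hasExpTrichotomy_of_isGreenKernel (hG : IsGreenKernel A G a b K)
    (hH : IsGreenKernel A H a' b' K') (h1 : a < b) (h2 : a' < b') (h3 : a < b')
    (hpos : 0 < ρ₀) (hlt : ρ₀ < ρ)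
    (hs : ∀ n m : ℤ, m ≤ n → ‖G n m‖ ≤ κ * Real.exp (-ρ * ((n : ℝ) - m)))
    (hu : ∀ n m : ℤ, m ≤ n → ‖backwardKernel H m n‖ ≤ κ * Real.exp (-ρ * ((n : ℝ) - m)))
    (hc : ∀ n m : ℤ, ‖partEvolution A (trichotomyProj G H .central) n m‖
      ≤ κ * Real.exp (ρ₀ * |(n : ℝ) - m|)) :
    HasExpTrichotomy A κ ρ₀ ρ (trichotomyProj G H) := by
  have hidem : ∀ t n, trichotomyProj G H t n * trichotomyProj G H t n = trichotomyProj G H t n := by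
    intro t n
    obtain ⟨r1, r2, r3, r4⟩ := hG.diag_relations hH h1 h2 h3 n
    cases t <;> simp only [trichotomyProj, sub_mul, mul_sub, one_mul, mul_one, r1, r2, r3, r4] <;>
      abel
  have hcomm := fun t n m (h : m ≤ n) => hG.commute_trichotomyProj hH t h
  have happly : ∀ {T Q : Y →L[𝕜] Y} {C : ℝ} (y : Y), T * Q = T → ‖T‖ ≤ C → ‖T (Q y)‖ ≤ C * ‖y‖ := by
    intro T Q C y hT hC
    have : T (Q y) = T y := congrArg (fun S : Y →L[𝕜] Y => S y) hT
    rw [this]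
    exact T.le_of_opNorm_le hC y
  refine ⟨hpos, hlt, hidem, fun n s t hst => ?_, fun n => ?_, hcomm,
    fun n m h => (hG.unstable_backward hH h2 h).1, fun n m h =>
    (hG.central_backward hH h1 h2 h3 h).1, fun y n m => ?_, fun y n m h => ?_, fun y n m h => ?_⟩
  · obtain ⟨r1, r2, r3, r4⟩ := hG.diag_relations hH h1 h2 h3 n
    change trichotomyProj G H s n * trichotomyProj G H t n = 0
    cases s <;> cases t <;> first
      | exact absurd rfl hst
      | (simp only [trichotomyProj, sub_mul, mul_sub, one_mul, mul_one, r1, r2, r3, r4]; abel)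
  · change G n n + (1 - H n n) + (H n n - G n n) = 1
    abel
  · refine happly y ?_ (hc n m)
    rcases le_total m n with h | h
    · exact partEvolution_mul_of_le h (hidem _ _) (hcomm _ n m h)
    · exact (partEvolution_inverse h (hidem _ _) (hcomm _ m n h)
        (hG.central_backward hH h1 h2 h3 h).1).2.2.2
  · refine happly y (partEvolution_mul_of_le h (hidem _ _) (hcomm _ n m h)) ?_
    rw [hG.partEvolution_stable h]
    exact hs n m h
  · obtain ⟨hinv, heq⟩ := hG.unstable_backward hH h2 h
    refine happly y (partEvolution_inverse h (hidem _ _) (hcomm _ n m h) hinv).2.2.2 ?_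
    rw [heq]
    exact hu n m h

end Trichotomy

/-! ### Ranges of nearby projectors -/

section CloseProjectors

variable {𝕜 : Type*} [RCLike 𝕜] {Y : Type*} [NormedAddCommGroup Y] [NormedSpace 𝕜 Y]

/-- A unit intertwining two operators identifies their ranges. -/
theorem nonempty_range_equiv_of_intertwine {P Q : Y →L[𝕜] Y} (u : (Y →L[𝕜] Y)ˣ)
    (hu : (u : Y →L[𝕜] Y) * P = Q * u) : Nonempty (P.range ≃L[𝕜] Q.range) := by
  have hu' : (↑u⁻¹ : Y →L[𝕜] Y) * Q = P * ↑u⁻¹ := by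
    rw [Units.inv_mul_eq_iff_eq_mul, ← mul_assoc, hu, mul_assoc, Units.mul_inv, mul_one]
  have happ : ∀ {S T S' T' : Y →L[𝕜] Y}, S * T = S' * T' → ∀ y, S (T y) = S' (T' y) :=
    fun h y => congrArg (fun L : Y →L[𝕜] Y => L y) h
  let f : P.range →L[𝕜] Q.range :=
    ((u : Y →L[𝕜] Y).comp P.range.subtypeL).codRestrict Q.range (by
      rintro ⟨_, z, rfl⟩
      exact ⟨(u : Y →L[𝕜] Y) z, (happ hu z).symm⟩)
  let g : Q.range →L[𝕜] P.range :=
    ((↑u⁻¹ : Y →L[𝕜] Y).comp Q.range.subtypeL).codRestrict P.range (by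
      rintro ⟨_, z, rfl⟩
      exact ⟨(↑u⁻¹ : Y →L[𝕜] Y) z, (happ hu' z).symm⟩)
  exact ⟨ContinuousLinearEquiv.equivOfInverse f g
    (fun y => Subtype.ext (congrArg (fun L : Y →L[𝕜] Y => L y) u.inv_mul))
    (fun y => Subtype.ext (congrArg (fun L : Y →L[𝕜] Y => L y) u.mul_inv))⟩

/-- Projectors which are close to each other have linearly homeomorphic ranges. -/
theorem nonempty_range_equiv_of_close [CompleteSpace Y] {P Q : Y →L[𝕜] Y} (hP : P * P = P)
    (hQ : Q * Q = Q) (h : (‖P‖ + ‖Q‖) * ‖Q - P‖ < 1) : Nonempty (P.range ≃L[𝕜] Q.range) := by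
  -- One minus this operator is `Q * P + (1 - Q) * (1 - P)`, which intertwines `P` and `Q`.
  -- Smallness makes it a unit.
  have hnorm : ‖Q * (Q - P) - (Q - P) * P‖ < 1 :=
    calc _ ≤ ‖Q‖ * ‖Q - P‖ + ‖Q - P‖ * ‖P‖ :=
          (norm_sub_le _ _).trans (add_le_add (norm_mul_le _ _) (norm_mul_le _ _))
      _ = (‖P‖ + ‖Q‖) * ‖Q - P‖ := by ring
      _ < 1 := h
  refine nonempty_range_equiv_of_intertwine (Units.oneSub _ hnorm) ?_
  rw [Units.val_oneSub]
  simp only [mul_sub, sub_mul, one_mul, mul_one, hP, hQ, ← mul_assoc]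
  simp only [mul_assoc, hP]
  abel

theorem HasExpTrichotomy.norm_projector_le {A : ℤ → Y →L[𝕜] Y} {κ ρ₀ ρ : ℝ}
    {P : TrichotomyPart → ℤ → Y →L[𝕜] Y} (h : HasExpTrichotomy A κ ρ₀ ρ P) (hκ : 0 ≤ κ)
    (t : TrichotomyPart) (n : ℤ) : ‖P t n‖ ≤ κ := by
  have hP : partEvolution A (P t) n n = P t n := by
    rw [partEvolution_of_le A _ le_rfl, evolution_self, mul_one]
  rw [← hP]
  cases t
  · simpa using h.norm_stable_le hκ (le_refl n)
  · simpa using h.norm_central_le hκ n n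
  · simpa using h.norm_unstable_le hκ (le_refl n)

end CloseProjectors

/-! ### Perturbation of trichotomies -/

section Perturbation

variable {𝕜 : Type*} [RCLike 𝕜] {Y : Type*} [NormedAddCommGroup Y] [NormedSpace 𝕜 Y]
  {A A' : ℤ → Y →L[𝕜] Y} {G H G' H' : ℤ → ℤ → Y →L[𝕜] Y}

/-- Two systems with close pairs of Green kernels have close central evolutions. -/
theorem norm_central_sub_le {a b c d a' b' c' d' K L K' L' ρ₀ ρ ε : ℝ}
    (hG : IsGreenKernel A G a b K) (hH : IsGreenKernel A H c d L)
    (hG' : IsGreenKernel A' G' a' b' K') (hH' : IsGreenKernel A' H' c' d' L')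
    (hab : a < b) (hcd : c < d) (had : a < d) (hab' : a' < b') (hcd' : c' < d') (had' : a' < d')
    (hε : 0 ≤ ε) (hρ₀ : 0 ≤ ρ₀) (hρ : ρ₀ ≤ ρ)
    (hGl : ∀ n m : ℤ, ‖G' n m - G n m‖ ≤ ε * Real.exp (-ρ * ((n : ℝ) - m)))
    (hGr : ∀ n m : ℤ, ‖G' n m - G n m‖ ≤ ε * Real.exp (-ρ₀ * ((n : ℝ) - m)))
    (hHl : ∀ n m : ℤ, ‖H' n m - H n m‖ ≤ ε * Real.exp (ρ₀ * ((n : ℝ) - m)))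
    (hHr : ∀ n m : ℤ, ‖H' n m - H n m‖ ≤ ε * Real.exp (ρ * ((n : ℝ) - m))) (n m : ℤ) :
    ‖partEvolution A' (trichotomyProj G' H' .central) n m -
        partEvolution A (trichotomyProj G H .central) n m‖
      ≤ 2 * ε * Real.exp (ρ₀ * |(n : ℝ) - m|) := by
  rcases le_total m n with h | h
  · have h' : 0 ≤ (n : ℝ) - m := sub_nonneg.2 (by exact_mod_cast h)
    rw [hG'.partEvolution_central hH' h, hG.partEvolution_central hH h, abs_of_nonneg h',
      show H' n m - G' n m - (H n m - G n m) = (H' n m - H n m) - (G' n m - G n m) by abel]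
    have hle : ε * Real.exp (-ρ * ((n : ℝ) - m)) ≤ ε * Real.exp (ρ₀ * ((n : ℝ) - m)) := by
      gcongr; linarith
    linarith [norm_sub_le (H' n m - H n m) (G' n m - G n m), hGl n m, hHl n m]
  · have h' : (n : ℝ) - m ≤ 0 := sub_nonpos.2 (by exact_mod_cast h)
    rw [(hG'.central_backward hH' hab' hcd' had' h).2, (hG.central_backward hH hab hcd had h).2,
      abs_of_nonpos h',
      show backwardKernel G' n m - backwardKernel H' n m -
        (backwardKernel G n m - backwardKernel H n m) = (H' n m - H n m) - (G' n m - G n m) by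
        unfold backwardKernel; abel]
    have hle : ε * Real.exp (ρ * ((n : ℝ) - m)) ≤ ε * Real.exp (-ρ₀ * ((n : ℝ) - m)) :=
      mul_le_mul_of_nonneg_left (Real.exp_le_exp.2
        (mul_le_mul_of_nonpos_right (by linarith) h')) hε
    have heq : -ρ₀ * ((n : ℝ) - m) = ρ₀ * -((n : ℝ) - m) := by ring
    rw [← heq]
    linarith [norm_sub_le (H' n m - H n m) (G' n m - G n m), hGr n m, hHr n m]

/-- Perturbation of an exponential trichotomy, with the error linear in the size of the
perturbation. -/
theorem HasExpTrichotomy.exists_perturbation [CompleteSpace Y] {κ κ' ρ₀ ρ₀' ρ' ρ C δ : ℝ}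
    {P : TrichotomyPart → ℤ → Y →L[𝕜] Y} {B : ℤ → Y →L[𝕜] Y}
    (hP : HasExpTrichotomy A κ ρ₀ ρ P) (hρ₀ : 0 < ρ₀) (hρ₀' : ρ₀ < ρ₀') (hρ' : ρ₀' < ρ')
    (hρ : ρ' < ρ) (hκ : 1 ≤ κ) (hB : ∀ n, ‖B n‖ ≤ δ)
    (hC1 : ∑' j, expKernel (-ρ) (-ρ₀) (-ρ') j ≤ C) (hC2 : ∑' j, expKernel (-ρ) (-ρ₀) (-ρ₀') j ≤ C)
    (hC3 : ∑' j, expKernel ρ₀ ρ ρ₀' j ≤ C) (hC4 : ∑' j, expKernel ρ₀ ρ ρ' j ≤ C)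
    (hsmall : 16 * κ ^ 2 * C * δ ≤ 1 / 4) (hsmall' : κ + 16 * κ ^ 2 * C * δ ≤ κ')
    (hclose : κ' * (16 * κ ^ 2 * C * δ) ≤ 1 / 4) :
    ∃ P' : TrichotomyPart → ℤ → Y →L[𝕜] Y,
      HasExpTrichotomy (fun n => A n + B n) κ' ρ₀' ρ' P' ∧
      (∀ t n, Nonempty ((P t n).range ≃L[𝕜] (P' t n).range)) ∧
      (∀ n p : ℤ, p ≤ n →
        ‖partEvolution (fun n => A n + B n) (P' .stable) n p - partEvolution A (P .stable) n p‖
          ≤ 16 * κ ^ 2 * C * δ * Real.exp (-ρ' * ((n : ℝ) - p))) ∧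
      (∀ n p : ℤ, p ≤ n →
        ‖partEvolution (fun n => A n + B n) (P' .unstable) p n - partEvolution A (P .unstable) p n‖
          ≤ 16 * κ ^ 2 * C * δ * Real.exp (-ρ' * ((n : ℝ) - p))) ∧
      (∀ n p : ℤ,
        ‖partEvolution (fun n => A n + B n) (P' .central) n p - partEvolution A (P .central) n p‖
          ≤ 16 * κ ^ 2 * C * δ * Real.exp (ρ₀' * |(n : ℝ) - p|)) := by
  have hκ0 : 0 ≤ κ := by linarith
  have hδ : 0 ≤ δ := (norm_nonneg _).trans (hB 0)
  have hC : 0 ≤ C := (tsum_nonneg (expKernel_nonneg _ _ _)).trans hC1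
  have hCδ : 0 ≤ C * δ := mul_nonneg hC hδ
  obtain ⟨G, H, hG, hH, hPeq⟩ := hP.exists_isGreenKernel hκ0
  have hsm : 2 * κ * δ * C ≤ 1 / 2 := by nlinarith
  obtain ⟨G', hG', hGl, hGr⟩ := hG.exists_perturbation hB (a' := -ρ') (b' := -ρ₀')
    (by linarith) (by linarith) (by linarith) hC1 hC2 hsm
  obtain ⟨H', hH', hHl, hHr⟩ := hH.exists_perturbation hB (a' := ρ₀') (b' := ρ')
    hρ₀' hρ' hρ hC3 hC4 hsm
  -- With kernel constant `2 * κ`, each kernel moves by at most half of `16 * κ ^ 2 * C * δ`. The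
  -- central part is a difference of two kernels and uses up both halves.
  have hε : 2 * (2 * κ) ^ 2 * C * δ = 16 * κ ^ 2 * C * δ / 2 := by ring
  rw [hε] at hGl hGr hHl hHr
  set ε := 16 * κ ^ 2 * C * δ with hεdef
  have hε0 : 0 ≤ ε := by rw [hεdef]; positivity
  have hs : ∀ n p : ℤ, p ≤ n → ‖partEvolution (fun n => A n + B n)
      (trichotomyProj G' H' .stable) n p - partEvolution A (P .stable) n p‖
      ≤ ε * Real.exp (-ρ' * ((n : ℝ) - p)) := by
    intro n p h
    rw [congrFun hPeq .stable, hG.partEvolution_stable h, hG'.partEvolution_stable h]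
    exact (hGl n p).trans (by gcongr; linarith)
  have hu : ∀ n p : ℤ, p ≤ n → ‖partEvolution (fun n => A n + B n)
      (trichotomyProj G' H' .unstable) p n - partEvolution A (P .unstable) p n‖
      ≤ ε * Real.exp (-ρ' * ((n : ℝ) - p)) := by
    intro n p h
    rw [congrFun hPeq .unstable, (hG.unstable_backward hH (by linarith) h).2,
      (hG'.unstable_backward hH' (by linarith) h).2, norm_sub_rev,
      show backwardKernel H p n - backwardKernel H' p n = H' p n - H p n by
        unfold backwardKernel; abel,
      show -ρ' * ((n : ℝ) - p) = ρ' * ((p : ℝ) - n) by ring]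
    exact (hHr p n).trans (by gcongr; linarith)
  have hc : ∀ n p : ℤ, ‖partEvolution (fun n => A n + B n)
      (trichotomyProj G' H' .central) n p - partEvolution A (P .central) n p‖
      ≤ ε * Real.exp (ρ₀' * |(n : ℝ) - p|) := by
    intro n p
    rw [congrFun hPeq .central]
    refine (norm_central_sub_le hG hH hG' hH' (by linarith) (by linarith) (by linarith)
      (by linarith) (by linarith) (by linarith) (by linarith) (by linarith) hρ'.le
      hGl hGr hHl hHr n p).trans_eq (by ring)
  have hadd : ∀ {S T : Y →L[𝕜] Y} {r s : ℝ}, r ≤ s → ‖S - T‖ ≤ ε * Real.exp s →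
      ‖T‖ ≤ κ * Real.exp r → ‖S‖ ≤ κ' * Real.exp s := by
    intro S T r s hrs h1 h2
    have h3 : κ * Real.exp r ≤ κ * Real.exp s := by gcongr
    have h4 := mul_le_mul_of_nonneg_right hsmall' (Real.exp_nonneg s)
    have h5 : ‖S‖ ≤ ‖T‖ + ‖S - T‖ := norm_le_norm_add_norm_sub' S T
    linarith
  have hT : HasExpTrichotomy (fun n => A n + B n) κ' ρ₀' ρ' (trichotomyProj G' H') := by
    refine hasExpTrichotomy_of_isGreenKernel hG' hH' (by linarith) (by linarith) (by linarith)
      (by linarith) hρ' (fun n m h => ?_) (fun n m h => ?_) fun n m => ?_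
    · have h' : 0 ≤ (n : ℝ) - m := sub_nonneg.2 (by exact_mod_cast h)
      rw [← hG'.partEvolution_stable (H := H') h]
      exact hadd (mul_le_mul_of_nonneg_right (by linarith) h') (hs n m h)
        (hP.norm_stable_le hκ0 h)
    · have h' : 0 ≤ (n : ℝ) - m := sub_nonneg.2 (by exact_mod_cast h)
      rw [← (hG'.unstable_backward hH' (by linarith) h).2]
      exact hadd (mul_le_mul_of_nonneg_right (by linarith) h') (hu n m h)
        (hP.norm_unstable_le hκ0 h)
    · exact hadd (mul_le_mul_of_nonneg_right hρ₀'.le (abs_nonneg _)) (hc n m)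
        (hP.norm_central_le hκ0 n m)
  refine ⟨trichotomyProj G' H', hT, fun t n => ?_, hs, hu, hc⟩
  refine nonempty_range_equiv_of_close (hP.projector_mul t n) (hT.projector_mul t n) ?_
  have hdiff : ‖trichotomyProj G' H' t n - P t n‖ ≤ ε := by
    have hself : ∀ (A : ℤ → Y →L[𝕜] Y) (P : ℤ → Y →L[𝕜] Y), partEvolution A P n n = P n :=
      fun A P => by rw [partEvolution_of_le A _ le_rfl, evolution_self, mul_one]
    have h1 := hs n n le_rfl
    have h2 := hu n n le_rfl
    have h3 := hc n n
    rw [hself, hself, sub_self] at h1 h2 h3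
    simp only [mul_zero, abs_zero, Real.exp_zero, mul_one] at h1 h2 h3
    cases t <;> assumption
  have hκκ' : κ ≤ κ' := by linarith
  calc _ ≤ (κ + κ') * ε := by
        gcongr
        · linarith
        · exact hP.norm_projector_le hκ0 t n
        · exact hT.norm_projector_le (hκ0.trans hκκ') t n
    _ ≤ (κ' + κ') * ε := by gcongr
    _ < 1 := by linarith

end Perturbation

/-! ### Choice of the threshold -/

theorem theorem1p8 (ρ₀ ρ₀' ρ' ρ κ κ' : ℝ)
    (hρ₀ : 0 < ρ₀) (hρ₀' : ρ₀ < ρ₀') (hρ' : ρ₀' < ρ') (hρ : ρ' < ρ)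
    (hκ : 1 ≤ κ) (hκ' : κ < κ') :
    ∃ δ₀ : ℝ, 0 < δ₀ ∧ δ₀ < Real.sqrt 2 - 1 ∧
      ∀ (𝕜 : Type*) [RCLike 𝕜]
        (Y : Type*) [NormedAddCommGroup Y] [NormedSpace 𝕜 Y] [CompleteSpace Y]
        (A : ℤ → Y →L[𝕜] Y) (P : TrichotomyPart → ℤ → Y →L[𝕜] Y),
        HasExpTrichotomy A κ ρ₀ ρ P →
        ∀ δ : ℝ, 0 < δ → δ < δ₀ ^ 2 / (κ + δ₀) →
        ∀ B : ℤ → Y →L[𝕜] Y, (∀ n : ℤ, ‖B n‖ ≤ δ) →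
        ∃ P' : TrichotomyPart → ℤ → Y →L[𝕜] Y,
          HasExpTrichotomy (fun n => A n + B n) κ' ρ₀' ρ' P' ∧
          (∀ (a : TrichotomyPart) (n : ℤ),
            Nonempty ((P a n).range ≃L[𝕜] (P' a n).range)) ∧
          (∀ n p : ℤ, p ≤ n →
            ‖partEvolution (fun n => A n + B n) (P' .stable) n p
                - partEvolution A (P .stable) n p‖
              ≤ κ * δ / (δ₀ - δ) * Real.exp (-ρ' * ((n : ℝ) - p))) ∧
          (∀ n p : ℤ, p ≤ n →
            ‖partEvolution (fun n => A n + B n) (P' .unstable) p n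
                - partEvolution A (P .unstable) p n‖
              ≤ κ * δ / (δ₀ - δ) * Real.exp (-ρ' * ((n : ℝ) - p))) ∧
          (∀ n p : ℤ,
            ‖partEvolution (fun n => A n + B n) (P' .central) n p
                - partEvolution A (P .central) n p‖
              ≤ κ * δ / (δ₀ - δ) * Real.exp (ρ₀' * |(n : ℝ) - p|)) := by
  -- One constant dominating the four row sums, for two kernels and two new rates each; the `1`
  -- makes it positive. It depends on the exponents only.
  set C : ℝ := ∑' j, expKernel (-ρ) (-ρ₀) (-ρ') j + ∑' j, expKernel (-ρ) (-ρ₀) (-ρ₀') j +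
    ∑' j, expKernel ρ₀ ρ ρ₀' j + ∑' j, expKernel ρ₀ ρ ρ' j + 1 with hCdef
  have hnn : ∀ a b c : ℝ, 0 ≤ ∑' j, expKernel a b c j := fun a b c =>
    tsum_nonneg (expKernel_nonneg a b c)
  have n1 := hnn (-ρ) (-ρ₀) (-ρ')
  have n2 := hnn (-ρ) (-ρ₀) (-ρ₀')
  have n3 := hnn ρ₀ ρ ρ₀'
  have n4 := hnn ρ₀ ρ ρ'
  have hC : 0 < C := by linarith
  have hκ0 : 0 < κ := by linarith
  have hκ'0 : 0 < κ' := by linarith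
  -- The admissible error, one bound per purpose: `κ` for the final form of the estimate, `κ' - κ`
  -- for the new trichotomy constant, `1 / 4` for the contraction, `1 / (4 * κ')` for conjugacy of
  -- the projectors.
  set η : ℝ := min (min κ (κ' - κ)) (min (1 / 4) (1 / (4 * κ'))) with hη
  have hη0 : 0 < η := by
    have := sub_pos.2 hκ'
    rw [hη]; positivity
  have e1 : η ≤ κ := (min_le_left _ _).trans (min_le_left _ _)
  have e2 : η ≤ κ' - κ := (min_le_left _ _).trans (min_le_right _ _)
  have e3 : η ≤ 1 / 4 := (min_le_right _ _).trans (min_le_left _ _)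
  have e4 : η ≤ 1 / (4 * κ') := (min_le_right _ _).trans (min_le_right _ _)
  have hD : 0 < 16 * κ ^ 2 * C := by positivity
  -- The value `1 / 4` lies below `√2 - 1`; the second term keeps the error at most `η`.
  set δ₀ : ℝ := min (1 / 4) (η / (16 * κ ^ 2 * C)) with hδ₀
  have hδ₀0 : 0 < δ₀ := by rw [hδ₀]; positivity
  have hδ₀D : 16 * κ ^ 2 * C * δ₀ ≤ η := by
    rw [mul_comm, ← le_div_iff₀ hD]
    exact min_le_right _ _
  refine ⟨δ₀, hδ₀0, ?_, ?_⟩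
  · have h2 : (5 / 4 : ℝ) < Real.sqrt 2 := Real.lt_sqrt_of_sq_lt (by norm_num)
    have : δ₀ ≤ 1 / 4 := min_le_left _ _
    linarith
  intro 𝕜 _ Y _ _ _ A P hP δ hδ0 hδ B hB
  have hδδ₀ : δ < δ₀ := by
    refine hδ.trans ?_
    rw [div_lt_iff₀ (by linarith)]
    nlinarith
  have hDδ : 16 * κ ^ 2 * C * δ ≤ η := (mul_le_mul_of_nonneg_left hδδ₀.le hD.le).trans hδ₀D
  -- The linear error fits the stated fraction because `16 * κ ^ 2 * C * (δ₀ - δ) ≤ η ≤ κ`.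
  have herr : 16 * κ ^ 2 * C * δ ≤ κ * δ / (δ₀ - δ) := by
    rw [le_div_iff₀ (sub_pos.2 hδδ₀)]
    have : 16 * κ ^ 2 * C * (δ₀ - δ) ≤ κ :=
      ((mul_le_mul_of_nonneg_left (by linarith) hD.le).trans hδ₀D).trans e1
    calc _ = 16 * κ ^ 2 * C * (δ₀ - δ) * δ := by ring
      _ ≤ κ * δ := by gcongr
  obtain ⟨P', h1, h2, h3, h4, h5⟩ := hP.exists_perturbation (C := C) hρ₀ hρ₀' hρ' hρ hκ hB
    (by linarith) (by linarith) (by linarith) (by linarith) (hDδ.trans e3) (by linarith)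
    (κ' := κ') (by
      calc κ' * (16 * κ ^ 2 * C * δ) ≤ κ' * (1 / (4 * κ')) := by gcongr; exact hDδ.trans e4
        _ = 1 / 4 := by field_simp)
  exact ⟨P', h1, h2, fun n p h => (h3 n p h).trans (by gcongr),
    fun n p h => (h4 n p h).trans (by gcongr), fun n p => (h5 n p).trans (by gcongr)⟩
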